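/- Let $n\ge 1$, $0<\alpha\le 1$ and $1<p<\infty$. Let $\Phi:(0,\infty)\to(0,\infty)$ be increasing (not necessarily strictly) and suppose that, for some constant $D$ with $1\le D<2^n$, $\Phi(2r)\le D\,\Phi(r)$ for all $r>0$. Let $L^{p,\Phi}(\mathbb R^n)$ be the space of all locally integrable functions $f$ (real- or complex-valued) on $\mathbb R^n$ for which there is a finite constant $C\ge 0$ with $\int_{B(x_0,r)}|f(x)|^p\,dx\le C^p\,\Phi(r)$ for all $x_0\in\mathbb R^n$ and $r>0$; the smallest such $C$ is denoted by $\|f\|_{L^{p,\Phi}}$. Let $\mathcal C_\alpha$ be the family of functions $\varphi:\mathbb R^n\to\mathbb R$ supported in $\{|x|\le 1\}$ with $\int_{\mathbb R^n}\varphi(x)\,dx=0$ and $|\varphi(x)-\varphi(x')|\le|x-x'|^\alpha$ for all $x,x'\in\mathbb R^n$; put $\varphi_t(x)=t^{-n}\varphi(x/t)$ for $t>0$. For locally integrable $f$ define $$A_\alpha(f)(x,t)=\sup_{\varphi\in\mathcal C_\alpha}\Big|\int_{\mathbb R^n}\varphi_t(x-z)f(z)\,dz\Big|,\qquad g_\alpha(f)(x)=\Big(\int_0^\infty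 A_\alpha(f)(x,t)^2\,\frac{dt}{t}\Big)^{1/2}\in[0,\infty].$$ Then there is a constant $C>0$, independent of $f$, such that for every $f\in L^{p,\Phi}(\mathbb R^n)$ one has $g_\alpha(f)\in L^{p,\Phi}(\mathbb R^n)$ (in particular, $g_\alpha(f)$ is finite almost everywhere) and $$\|g_\alpha(f)\|_{L^{p,\Phi}}\le C\,\|f\|_{L^{p,\Phi}}.$$ -/

import Mathlib

open scoped ENNReal NNReal

noncomputable section

namespace IntrinsicMorrey

/-- A growth function: positive and increasing on `(0, ∞)`, with the doubling condition
`Φ (2 r) ≤ D * Φ r` for all `r > 0`, where `D ≥ 1`. Values of `Φ` outside `(0, ∞)` play no role. -/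
structure IsGrowthFunction (Φ : ℝ → ℝ) (D : ℝ) : Prop where
  pos : ∀ r : ℝ, 0 < r → 0 < Φ r
  mono : MonotoneOn Φ (Set.Ioi 0)
  one_le : 1 ≤ D
  doubling : ∀ r : ℝ, 0 < r → Φ (2 * r) ≤ D * Φ r

/-- The family `𝒞_α`: real functions on `ℝⁿ` supported in the closed unit ball, with mean zero and
`|φ x - φ x'| ≤ |x - x'| ^ α`. -/
structure IsAdmissible {n : ℕ} (α : ℝ) (φ : EuclideanSpace ℝ (Fin n) → ℝ) : Prop where
  support_subset : Function.support φ ⊆ Metric.closedBall 0 1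
  integral_eq_zero : ∫ x, φ x = 0
  holder : ∀ x x' : EuclideanSpace ℝ (Fin n), |φ x - φ x'| ≤ ‖x - x'‖ ^ α

/-- The dilation `φ_t (x) = t⁻ⁿ φ (x / t)`. -/
def dilate {n : ℕ} (φ : EuclideanSpace ℝ (Fin n) → ℝ) (t : ℝ) (x : EuclideanSpace ℝ (Fin n)) : ℝ :=
  (t ^ n)⁻¹ * φ (t⁻¹ • x)

variable {𝕜 : Type*} [RCLike 𝕜] {n : ℕ}

/-- `A_α(f)(y, t) = sup_{φ ∈ 𝒞_α} |∫ φ_t (y - z) f z dz|`, with values in `[0, ∞]`. -/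
def supConv (α : ℝ) (f : EuclideanSpace ℝ (Fin n) → 𝕜) (y : EuclideanSpace ℝ (Fin n)) (t : ℝ) :
    ℝ≥0∞ :=
  ⨆ (φ : EuclideanSpace ℝ (Fin n) → ℝ) (_ : IsAdmissible α φ), ‖∫ z, dilate φ t (y - z) • f z‖ₑ

/-- The intrinsic Littlewood–Paley function `g_α(f)(x) = (∫₀^∞ A_α(f)(x, t)² dt / t) ^ (1/2)`,
with values in `[0, ∞]`. -/
def gFun (α : ℝ) (f : EuclideanSpace ℝ (Fin n) → 𝕜) (x : EuclideanSpace ℝ (Fin n)) : ℝ≥0∞ :=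
  (∫⁻ t in Set.Ioi (0 : ℝ), supConv α f x t ^ (2 : ℕ) / ENNReal.ofReal t) ^ (1 / 2 : ℝ)

/-- The norm of the generalized Morrey space `L^{p,Φ}`: the smallest constant `C ∈ [0, ∞]` with
`∫_{B(x₀, r)} |f|^p ≤ C^p Φ r` for all balls. The target `ε` is `ℝ`, `ℂ`, or `[0, ∞]`. -/
def morreyNorm {ε : Type*} [ENorm ε] (p : ℝ) (Φ : ℝ → ℝ) (f : EuclideanSpace ℝ (Fin n) → ε) :
    ℝ≥0∞ :=
  sInf {C : ℝ≥0∞ | ∀ (x₀ : EuclideanSpace ℝ (Fin n)) (r : ℝ), 0 < r →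
    ∫⁻ x in Metric.ball x₀ r, ‖f x‖ₑ ^ p ≤ C ^ p * ENNReal.ofReal (Φ r)}

/-- Membership in `L^{p,Φ}`: locally integrable with finite norm. -/
def MemMorrey {ε : Type*} [TopologicalSpace ε] [ContinuousENorm ε] (p : ℝ) (Φ : ℝ → ℝ)
    (f : EuclideanSpace ℝ (Fin n) → ε) : Prop :=
  MeasureTheory.LocallyIntegrable f ∧ morreyNorm p Φ f < ∞

end IntrinsicMorrey

end

/-!
Consider dyadic grids translated by `0` or one third of their top side in each coordinate. Every
ball of radius `t` lies in a cube `Q` of comparable side of one of these finitely many grids.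
Expand `f` inside `Q` in the martingale differences of the grid. An admissible `φ_t` has mean zero,
which removes the average over `Q`, and the Hölder condition bounds its oscillation over the cubes
`m` generations below by a multiple of `2 ^ (-α m)`. Hence `A_α(f)(x, t)` is dominated by a
geometrically damped sum of averages over `Q` of the martingale differences of `f`.

The corresponding martingale square functions are bounded on `L^p`. For `1 < p ≤ 2` this follows
from a quantitative convexity inequality for `x ↦ x ^ p`, summed over generations, and from Doob's
maximal inequality; for `p > 2` it follows by duality from the case `p = 2` with weights.

For the Morrey norm on `B(x₀, r)`, split `f` at the ball `B(x₀, 2r)`. The inner part is controlled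
by the `L^p` bound. For the outer part only `t ≥ r` contributes, and the averages of `|f|^p` over
balls of radius `2 ^ j r` decay like `(D / 2 ^ n) ^ j`.
-/

open MeasureTheory Set Filter Topology
open scoped ENNReal NNReal

noncomputable section

namespace IntrinsicMorrey

section ENNReal

lemma rpow_sub_one_mul_self {q : ℝ} (hq : 1 ≤ q) (a : ℝ≥0∞) : a ^ (q - 1) * a = a ^ q := by
  nth_rw 2 [← ENNReal.rpow_one a]
  rw [← ENNReal.rpow_add_of_nonneg _ _ (sub_nonneg.2 hq) zero_le_one, sub_add_cancel]

lemma le_rpow_mul_of_le_mul_rpow {a b c : ℝ≥0∞} {s : ℝ} (hs : 0 < s) (ha : a ≠ ∞)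
    (h : a ≤ c * (b ^ s * a ^ (1 - s))) : a ≤ c ^ s⁻¹ * b := by
  rcases eq_or_ne a 0 with rfl | ha0
  · exact zero_le
  have h0 : a ^ (1 - s) ≠ 0 := by simp [ha0, ha]
  have ht : a ^ (1 - s) ≠ ∞ := by simp [ha0, ha]
  have hpow : a ^ s ≤ c * b ^ s := by
    refine (ENNReal.mul_le_mul_iff_left h0 ht).1 ?_
    calc a ^ s * a ^ (1 - s) = a := by rw [← ENNReal.rpow_add _ _ ha0 ha]; simp
      _ ≤ c * b ^ s * a ^ (1 - s) := h.trans_eq (mul_assoc _ _ _).symm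
  calc a = (a ^ s) ^ s⁻¹ := (ENNReal.rpow_rpow_inv hs.ne' a).symm
    _ ≤ (c * b ^ s) ^ s⁻¹ := ENNReal.rpow_le_rpow hpow (by positivity)
    _ = c ^ s⁻¹ * b := by
        rw [ENNReal.mul_rpow_of_nonneg _ _ (by positivity), ENNReal.rpow_rpow_inv hs.ne']

lemma sum_range_add_le (a : ℕ → ℝ≥0∞) (m N : ℕ) :
    ∑ k ∈ Finset.range N, a (k + m) ≤ ∑ j ∈ Finset.range (N + m), a j := by
  rw [add_comm N m, Finset.sum_range_add]
  simp only [add_comm m]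
  exact le_add_self

-- Split `τ ^ (2 * m) = τ ^ m * τ ^ m` and bound `τ ^ m * c m` by the `ℓ^r` norm of that sequence.
lemma tsum_pow_two_mul_mul_rpow_le (τ : ℝ≥0∞) (c : ℕ → ℝ≥0∞) {r : ℝ} (hr : 0 < r) :
    (∑' m, τ ^ (2 * m) * c m) ^ r ≤ (1 - τ)⁻¹ ^ r * ∑' m, (τ ^ m * c m) ^ r := by
  set S := ∑' m, (τ ^ m * c m) ^ r
  have hterm (m : ℕ) : τ ^ m * c m ≤ S ^ r⁻¹ :=
    (ENNReal.le_rpow_inv_iff hr).2 (ENNReal.le_tsum m)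
  calc (∑' m, τ ^ (2 * m) * c m) ^ r ≤ (∑' m, τ ^ m * S ^ r⁻¹) ^ r := by
        refine ENNReal.rpow_le_rpow (ENNReal.tsum_le_tsum fun m => ?_) hr.le
        rw [two_mul, pow_add, mul_assoc]
        gcongr
        exact hterm m
    _ = (1 - τ)⁻¹ ^ r * S := by
        rw [ENNReal.tsum_mul_right, ENNReal.tsum_geometric, ENNReal.mul_rpow_of_nonneg _ _ hr.le,
          ENNReal.rpow_inv_rpow hr.ne']

end ENNReal

section LIntegral

variable {X : Type*} [MeasurableSpace X] {μ : Measure X}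

lemma lintegral_rpow_le_of_le_add {u v w : X → ℝ≥0∞} (hu : AEMeasurable u μ)
    (h : ∀ x, w x ≤ u x + v x) {p : ℝ} (hp : 1 ≤ p) :
    ∫⁻ x, w x ^ p ∂μ ≤ 2 ^ (p - 1) * ((∫⁻ x, u x ^ p ∂μ) + ∫⁻ x, v x ^ p ∂μ) := by
  calc ∫⁻ x, w x ^ p ∂μ ≤ ∫⁻ x, 2 ^ (p - 1) * (u x ^ p + v x ^ p) ∂μ :=
        lintegral_mono fun x => (ENNReal.rpow_le_rpow (h x) (by positivity)).trans
          (ENNReal.rpow_add_le_mul_rpow_add_rpow _ _ hp)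
    _ = 2 ^ (p - 1) * ((∫⁻ x, u x ^ p ∂μ) + ∫⁻ x, v x ^ p ∂μ) := by
        rw [lintegral_const_mul' _ _ (ENNReal.rpow_ne_top_of_nonneg (sub_nonneg.2 hp) (by simp)),
          lintegral_add_left' (hu.pow_const p)]

lemma rpow_lintegral_le [IsProbabilityMeasure μ] {u : X → ℝ≥0∞} (hu : AEMeasurable u μ) {q : ℝ}
    (hq : 1 ≤ q) : (∫⁻ x, u x ∂μ) ^ q ≤ ∫⁻ x, u x ^ q ∂μ := by
  have h := eLpNorm'_le_eLpNorm'_of_exponent_le zero_lt_one hq μ hu.aestronglyMeasurable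
  simpa [eLpNorm', ← ENNReal.le_rpow_inv_iff (zero_lt_one.trans_le hq)] using h

lemma rpow_setLAverage_le {u : X → ℝ≥0∞} {s : Set X} (hu : AEMeasurable u (μ.restrict s))
    (hs : μ s ≠ ∞) {q : ℝ} (hq : 1 ≤ q) :
    (⨍⁻ x in s, u x ∂μ) ^ q ≤ ⨍⁻ x in s, u x ^ q ∂μ := by
  rcases eq_or_ne (μ s) 0 with h0 | h0
  · simp [Measure.restrict_eq_zero.2 h0, zero_lt_one.trans_le hq]
  have : IsProbabilityMeasure ((μ s)⁻¹ • μ.restrict s) :=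
    ⟨by simpa using ENNReal.inv_mul_cancel h0 hs⟩
  simp only [setLAverage_eq']
  exact rpow_lintegral_le (hu.smul_measure _) hq

end LIntegral

/-! ### Cell filtrations -/

/-- A refining sequence of measurable partitions of a measure space into cells of positive finite
measure, such that a cell has at most `D` times the measure of each of its children. The cells of
generation `k` are the fibers of `label k`. -/
structure CellFiltration {X : Type*} [MeasurableSpace X] (μ : Measure X) (ι : Type*)
    [MeasurableSpace ι] (D : ℝ≥0) where
  label : ℕ → X → ι
  measurable_label : ∀ k, Measurable (label k)
  refines : ∀ k x y, label (k + 1) x = label (k + 1) y → label k x = label k y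
  measure_ne_zero : ∀ k x, μ {y | label k y = label k x} ≠ 0
  measure_ne_top : ∀ k x, μ {y | label k y = label k x} ≠ ∞
  doubling : ∀ k x, μ {y | label k y = label k x} ≤ D * μ {y | label (k + 1) y = label (k + 1) x}

namespace CellFiltration

variable {X : Type*} [MeasurableSpace X] {μ : Measure X} {ι : Type*} [MeasurableSpace ι] {D : ℝ≥0}
  (F : CellFiltration μ ι D)

/-- The cell of generation `k` containing `x`. -/
def cell (k : ℕ) (x : X) : Set X := {y | F.label k y = F.label k x}

/-- Averages of `[0, ∞]`-valued functions over the cells of generation `k`. -/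
def lmean (k : ℕ) (u : X → ℝ≥0∞) (x : X) : ℝ≥0∞ := ⨍⁻ y in F.cell k x, u y ∂μ

/-- Averages of real functions over the cells of generation `k`. -/
def mean (k : ℕ) (f : X → ℝ) (x : X) : ℝ := ⨍ y in F.cell k x, f y ∂μ

/-- The martingale difference between generations `k` and `k + 1`. -/
def diff (k : ℕ) (f : X → ℝ) (x : X) : ℝ := F.mean (k + 1) f x - F.mean k f x

/-- A function is constant on the cells of generation `k`. -/
def IsConst {β : Type*} (k : ℕ) (W : X → β) : Prop :=
  ∀ x y, F.label k x = F.label k y → W x = W y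

lemma cell_congr {k : ℕ} {x y : X} (h : F.label k x = F.label k y) : F.cell k x = F.cell k y := by
  simp [cell, h]

lemma label_of_le {j k : ℕ} (hjk : j ≤ k) {x y : X} (h : F.label k x = F.label k y) :
    F.label j x = F.label j y := by
  induction k, hjk using Nat.le_induction with
  | base => exact h
  | succ k _ ih => exact ih (F.refines k x y h)

lemma cell_subset_of_le {j k : ℕ} (hjk : j ≤ k) (x : X) : F.cell k x ⊆ F.cell j x :=
  fun _ hy => F.label_of_le hjk hy

include F in
lemma one_le [Nonempty X] : 1 ≤ D := by
  obtain ⟨x⟩ := ‹Nonempty X›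
  have h : 1 * μ (F.cell 1 x) ≤ D * μ (F.cell 1 x) := by
    rw [one_mul]
    exact (measure_mono (F.cell_subset_of_le zero_le_one x)).trans (F.doubling 0 x)
  exact_mod_cast (ENNReal.mul_le_mul_iff_left (F.measure_ne_zero 1 x) (F.measure_ne_top 1 x)).1 h

variable {F} in
lemma IsConst.mono {β : Type*} {j k : ℕ} {W : X → β} (h : F.IsConst j W) (hjk : j ≤ k) :
    F.IsConst k W := fun x y hxy => h x y (F.label_of_le hjk hxy)

lemma isConst_lmean (k : ℕ) (u : X → ℝ≥0∞) : F.IsConst k (F.lmean k u) := fun x y h => by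
  simp only [lmean, F.cell_congr h]

lemma isConst_mean (k : ℕ) (f : X → ℝ) : F.IsConst k (F.mean k f) := fun x y h => by
  simp only [mean, F.cell_congr h]

lemma isConst_diff (k : ℕ) (f : X → ℝ) : F.IsConst (k + 1) (F.diff k f) := fun x y h => by
  simp only [diff, F.isConst_mean (k + 1) f x y h,
    (F.isConst_mean k f).mono (Nat.le_succ k) x y h]

instance isProbabilityMeasure_cell (k : ℕ) (x : X) :
    IsProbabilityMeasure ((μ (F.cell k x))⁻¹ • μ.restrict (F.cell k x)) :=
  ⟨by
    rw [Measure.smul_apply, Measure.restrict_apply_univ, smul_eq_mul]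
    exact ENNReal.inv_mul_cancel (F.measure_ne_zero k x) (F.measure_ne_top k x)⟩

lemma lmean_eq (k : ℕ) (u : X → ℝ≥0∞) (x : X) :
    F.lmean k u x = ∫⁻ y, u y ∂((μ (F.cell k x))⁻¹ • μ.restrict (F.cell k x)) := by
  rw [lmean, setLAverage_eq']

lemma measure_mul_lmean (k : ℕ) (u : X → ℝ≥0∞) (x : X) :
    μ (F.cell k x) * F.lmean k u x = ∫⁻ y in F.cell k x, u y ∂μ :=
  measure_mul_setLAverage _ (F.measure_ne_top k x)

lemma lmean_mono {k : ℕ} {u v : X → ℝ≥0∞} {x : X} (h : ∀ y, u y ≤ v y) :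
    F.lmean k u x ≤ F.lmean k v x := by
  simp only [lmean_eq]
  exact lintegral_mono h

lemma lmean_rpow_le (k : ℕ) {u : X → ℝ≥0∞} (hu : Measurable u) {s : ℝ} (h0 : 0 ≤ s) (h1 : s ≤ 1)
    (x : X) : F.lmean k (fun y => u y ^ s) x ≤ F.lmean k u x ^ s := by
  simp only [lmean_eq]
  have := ENNReal.lintegral_mul_norm_pow_le
    (μ := (μ (F.cell k x))⁻¹ • μ.restrict (F.cell k x)) hu.aemeasurable
    (aemeasurable_const (b := (1 : ℝ≥0∞))) h0 (sub_nonneg.2 h1) (by ring)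
  simpa only [ENNReal.one_rpow, mul_one, lintegral_one, measure_univ] using this

lemma rpow_lmean_le (k : ℕ) {u : X → ℝ≥0∞} (hu : Measurable u) {q : ℝ} (hq : 1 ≤ q) (x : X) :
    F.lmean k u x ^ q ≤ F.lmean k (fun y => u y ^ q) x :=
  rpow_setLAverage_le hu.aemeasurable (F.measure_ne_top k x) hq

lemma lmean_mul_rpow_le (k : ℕ) {u v : X → ℝ≥0∞} (hu : Measurable u) (hv : Measurable v) (x : X) :
    F.lmean k (fun y => u y ^ (1 / 2 : ℝ) * v y ^ (1 / 2 : ℝ)) x ≤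
      F.lmean k u x ^ (1 / 2 : ℝ) * F.lmean k v x ^ (1 / 2 : ℝ) := by
  simp only [lmean_eq]
  exact ENNReal.lintegral_mul_norm_pow_le hu.aemeasurable hv.aemeasurable (by norm_num)
    (by norm_num) (by norm_num)

/-- The martingale maximal function, restricted to generations at most `N`. -/
def maxFun (N : ℕ) (u : X → ℝ≥0∞) (x : X) : ℝ≥0∞ := ⨆ k ≤ N, F.lmean k u x

lemma isConst_maxFun (N : ℕ) (u : X → ℝ≥0∞) : F.IsConst N (F.maxFun N u) := fun x y h => by
  simp only [maxFun]
  exact iSup_congr fun k => iSup_congr fun hk => (F.isConst_lmean k u).mono hk x y h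

lemma lmean_le_maxFun {k N : ℕ} (hk : k ≤ N) (u : X → ℝ≥0∞) (x : X) :
    F.lmean k u x ≤ F.maxFun N u x := le_iSup₂ (f := fun k (_ : k ≤ N) => F.lmean k u x) k hk

lemma maxFun_mono {M N : ℕ} (h : M ≤ N) (u : X → ℝ≥0∞) (x : X) : F.maxFun M u x ≤ F.maxFun N u x :=
  iSup₂_le fun _ hk => F.lmean_le_maxFun (hk.trans h) u x

lemma maxFun_zero (u : X → ℝ≥0∞) (x : X) : F.maxFun 0 u x = F.lmean 0 u x := by
  simp [maxFun]

lemma maxFun_succ (N : ℕ) (u : X → ℝ≥0∞) (x : X) :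
    F.maxFun (N + 1) u x = max (F.maxFun N u x) (F.lmean (N + 1) u x) := by
  refine le_antisymm (iSup₂_le fun k hk => ?_) (max_le (F.maxFun_mono N.le_succ u x)
    (F.lmean_le_maxFun le_rfl u x))
  rcases Nat.le_succ_iff.1 hk with h | rfl
  · exact (F.lmean_le_maxFun h u x).trans (le_max_left _ _)
  · exact le_max_right _ _

variable [MeasurableSingletonClass ι]

lemma measurableSet_cell (k : ℕ) (x : X) : MeasurableSet (F.cell k x) :=
  F.measurable_label k (measurableSet_singleton (F.label k x))

lemma setLIntegral_isConst {k : ℕ} {W : X → ℝ≥0∞} (hW : F.IsConst k W) (x : X) :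
    ∫⁻ y in F.cell k x, W y ∂μ = W x * μ (F.cell k x) := by
  rw [setLIntegral_congr_fun (F.measurableSet_cell k x) (fun y hy => hW y x hy),
    setLIntegral_const]

lemma setLIntegral_mul_isConst {k : ℕ} {u W : X → ℝ≥0∞} (hu : Measurable u) (hW : F.IsConst k W)
    (x : X) :
    ∫⁻ y in F.cell k x, u y * W y ∂μ = (∫⁻ y in F.cell k x, u y ∂μ) * W x := by
  rw [setLIntegral_congr_fun (g := fun y => u y * W x) (F.measurableSet_cell k x)
    (fun y hy => by simp only [hW y x hy]), lintegral_mul_const _ hu]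

lemma setLIntegral_lmean (k : ℕ) (u : X → ℝ≥0∞) (x : X) :
    ∫⁻ y in F.cell k x, F.lmean k u y ∂μ = ∫⁻ y in F.cell k x, u y ∂μ := by
  rw [F.setLIntegral_isConst (F.isConst_lmean k u), mul_comm, measure_mul_lmean]

variable [Countable ι]

variable {F} in
lemma IsConst.measurable {β : Type*} [MeasurableSpace β] {k : ℕ} {W : X → β} (h : F.IsConst k W) :
    Measurable W := by
  intro s _
  have : W ⁻¹' s = F.label k ⁻¹' (F.label k '' (W ⁻¹' s)) := by
    ext x
    simp only [mem_preimage, mem_image]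
    exact ⟨fun hx => ⟨x, hx, rfl⟩, fun ⟨y, hy, hxy⟩ => h x y hxy.symm ▸ hy⟩
  rw [this]
  exact F.measurable_label k (Set.to_countable _).measurableSet

lemma measurable_lmean (k : ℕ) (u : X → ℝ≥0∞) : Measurable (F.lmean k u) :=
  (F.isConst_lmean k u).measurable

lemma measurable_maxFun (N : ℕ) (u : X → ℝ≥0∞) : Measurable (F.maxFun N u) :=
  (F.isConst_maxFun N u).measurable

lemma measurable_mean (k : ℕ) (f : X → ℝ) : Measurable (F.mean k f) :=
  (F.isConst_mean k f).measurable

lemma measurable_diff (k : ℕ) (f : X → ℝ) : Measurable (F.diff k f) :=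
  (F.isConst_diff k f).measurable

lemma lintegral_eq_tsum_fibers (k : ℕ) (u : X → ℝ≥0∞) :
    ∫⁻ x, u x ∂μ = ∑' i, ∫⁻ x in F.label k ⁻¹' {i}, u x ∂μ := by
  rw [← lintegral_iUnion (fun i => F.measurable_label k (measurableSet_singleton i)),
    ← preimage_iUnion, iUnion_of_singleton, preimage_univ, setLIntegral_univ]
  intro i j hij
  exact Disjoint.preimage _ (by simpa using hij)

lemma lintegral_le_of_cells (k : ℕ) {u v : X → ℝ≥0∞}
    (h : ∀ x, ∫⁻ y in F.cell k x, u y ∂μ ≤ ∫⁻ y in F.cell k x, v y ∂μ) :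
    ∫⁻ x, u x ∂μ ≤ ∫⁻ x, v x ∂μ := by
  rw [F.lintegral_eq_tsum_fibers k, F.lintegral_eq_tsum_fibers k]
  refine ENNReal.tsum_le_tsum fun i => ?_
  rcases (F.label k ⁻¹' {i}).eq_empty_or_nonempty with he | ⟨x, hx⟩
  · simp [he]
  · obtain rfl : F.label k x = i := hx
    exact h x

lemma lintegral_lmean_mul (k : ℕ) {u W : X → ℝ≥0∞} (hu : Measurable u) (hW : F.IsConst k W) :
    ∫⁻ x, F.lmean k u x * W x ∂μ = ∫⁻ x, u x * W x ∂μ := by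
  have : ∀ x, ∫⁻ y in F.cell k x, F.lmean k u y * W y ∂μ = ∫⁻ y in F.cell k x, u y * W y ∂μ := by
    intro x
    rw [F.setLIntegral_mul_isConst (F.measurable_lmean k u) hW,
      F.setLIntegral_mul_isConst hu hW, setLIntegral_lmean]
  exact le_antisymm (F.lintegral_le_of_cells k fun x => (this x).le)
    (F.lintegral_le_of_cells k fun x => (this x).ge)

lemma lintegral_lmean (k : ℕ) {u : X → ℝ≥0∞} (hu : Measurable u) :
    ∫⁻ x, F.lmean k u x ∂μ = ∫⁻ x, u x ∂μ := by
  simpa using F.lintegral_lmean_mul k (W := fun _ => 1) hu (fun _ _ _ => rfl)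

lemma lintegral_lmean_mul_comm (k : ℕ) {u v : X → ℝ≥0∞} (hu : Measurable u) (hv : Measurable v) :
    ∫⁻ x, F.lmean k u x * v x ∂μ = ∫⁻ x, u x * F.lmean k v x ∂μ := by
  rw [← F.lintegral_lmean_mul k hu (F.isConst_lmean k v)]
  simp only [mul_comm (F.lmean k u _)]
  rw [F.lintegral_lmean_mul k hv (F.isConst_lmean k u)]

lemma lintegral_lmean_rpow_le (k : ℕ) {u : X → ℝ≥0∞} (hu : Measurable u) {q : ℝ} (hq : 1 ≤ q) :
    ∫⁻ x, F.lmean k u x ^ q ∂μ ≤ ∫⁻ x, u x ^ q ∂μ := by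
  rw [← F.lintegral_lmean k (hu.pow_const q)]
  exact lintegral_mono fun x => F.rpow_lmean_le k hu hq x

lemma lintegral_lmean_succ_mul (k : ℕ) {u W : X → ℝ≥0∞} (hu : Measurable u) (hW : F.IsConst k W) :
    ∫⁻ x, F.lmean (k + 1) u x * W x ∂μ = ∫⁻ x, F.lmean k u x * W x ∂μ := by
  rw [F.lintegral_lmean_mul k hu hW, F.lintegral_lmean_mul (k + 1) hu (hW.mono (Nat.le_succ k))]

end CellFiltration

/-! ### The Doob maximal inequality -/

lemma max_rpow_add_le {q : ℝ} (hq : 1 < q) (a b : ℝ≥0∞) :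
    ENNReal.ofReal (q - 1) * max a b ^ q + ENNReal.ofReal q * (a ^ (q - 1) * b) ≤
      ENNReal.ofReal q * (max a b ^ (q - 1) * b) + ENNReal.ofReal (q - 1) * a ^ q := by
  rcases le_total b a with h | h
  · rw [max_eq_left h, add_comm]
  have hq0 : ENNReal.ofReal q ≠ 0 := by simpa using by linarith
  have hq1 : ENNReal.ofReal q = ENNReal.ofReal (q - 1) + 1 := by
    rw [← ENNReal.ofReal_one, ← ENNReal.ofReal_add (by linarith) zero_le_one, sub_add_cancel]
  have young : ENNReal.ofReal q * (a ^ (q - 1) * b) ≤ b ^ q + ENNReal.ofReal (q - 1) * a ^ q := by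
    have h := ENNReal.young_inequality b (a ^ (q - 1)) (Real.HolderConjugate.conjExponent hq)
    rw [← ENNReal.rpow_mul, Real.conjExponent, mul_div_cancel₀ _ (by linarith : q - 1 ≠ 0),
      ENNReal.ofReal_div_of_pos (by linarith)] at h
    calc ENNReal.ofReal q * (a ^ (q - 1) * b)
        ≤ ENNReal.ofReal q * (b ^ q / ENNReal.ofReal q +
            a ^ q / (ENNReal.ofReal q / ENNReal.ofReal (q - 1))) := by
          rw [mul_comm (a ^ (q - 1))]
          gcongr
      _ = b ^ q + ENNReal.ofReal (q - 1) * a ^ q := by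
          rw [mul_add, ENNReal.mul_div_cancel hq0 ENNReal.ofReal_ne_top, div_eq_mul_inv (a ^ q),
            ENNReal.inv_div (Or.inl ENNReal.ofReal_ne_top) (Or.inl (by simpa using hq)),
            mul_comm (a ^ q), ← mul_assoc, ENNReal.mul_div_cancel hq0 ENNReal.ofReal_ne_top]
  rw [max_eq_right h, rpow_sub_one_mul_self hq.le]
  calc ENNReal.ofReal (q - 1) * b ^ q + ENNReal.ofReal q * (a ^ (q - 1) * b)
      ≤ ENNReal.ofReal (q - 1) * b ^ q + (b ^ q + ENNReal.ofReal (q - 1) * a ^ q) := by gcongr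
    _ = ENNReal.ofReal q * b ^ q + ENNReal.ofReal (q - 1) * a ^ q := by rw [hq1]; ring

namespace CellFiltration

variable {X : Type*} [MeasurableSpace X] {μ : Measure X} {ι : Type*} [MeasurableSpace ι] {D : ℝ≥0}
  (F : CellFiltration μ ι D) [Countable ι] [MeasurableSingletonClass ι]

lemma lintegral_maxFun_rpow_lt_top (N : ℕ) {u : X → ℝ≥0∞} (hu : Measurable u) {q : ℝ} (hq : 1 ≤ q)
    (hfin : ∫⁻ x, u x ^ q ∂μ < ∞) : ∫⁻ x, F.maxFun N u x ^ q ∂μ < ∞ := by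
  have hlt (k : ℕ) : ∫⁻ x, F.lmean k u x ^ q ∂μ < ∞ :=
    (F.lintegral_lmean_rpow_le k hu hq).trans_lt hfin
  induction N with
  | zero => simpa only [maxFun_zero] using hlt 0
  | succ N ih =>
    calc ∫⁻ x, F.maxFun (N + 1) u x ^ q ∂μ
        ≤ ∫⁻ x, (F.maxFun N u + F.lmean (N + 1) u) x ^ q ∂μ :=
          lintegral_mono fun x => ENNReal.rpow_le_rpow
            ((F.maxFun_succ N u x).trans_le (max_le le_self_add le_add_self)) (by linarith)
      _ < ∞ := ENNReal.lintegral_rpow_add_lt_top_of_lintegral_rpow_lt_top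
          (F.measurable_maxFun N u).aemeasurable ih (hlt _) hq

lemma lintegral_maxFun_rpow_mul_lmean_succ (N : ℕ) {u : X → ℝ≥0∞} (hu : Measurable u) (s : ℝ) :
    ∫⁻ x, F.maxFun N u x ^ s * F.lmean (N + 1) u x ∂μ =
      ∫⁻ x, F.maxFun N u x ^ s * F.lmean N u x ∂μ := by
  simp only [mul_comm (F.maxFun N u _ ^ s)]
  exact F.lintegral_lmean_succ_mul N hu fun x y h => by rw [F.isConst_maxFun N u x y h]

lemma lintegral_maxFun_rpow_le_mul (N : ℕ) {u : X → ℝ≥0∞} (hu : Measurable u) {q : ℝ} (hq : 1 < q)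
    (hfin : ∫⁻ x, u x ^ q ∂μ < ∞) :
    ENNReal.ofReal (q - 1) * ∫⁻ x, F.maxFun N u x ^ q ∂μ ≤
      ENNReal.ofReal q * ∫⁻ x, F.maxFun N u x ^ (q - 1) * F.lmean N u x ∂μ := by
  induction N with
  | zero =>
    simp only [maxFun_zero, rpow_sub_one_mul_self hq.le]
    gcongr
    linarith
  | succ N ih =>
    have hm := F.measurable_maxFun N u
    have hm' := F.measurable_maxFun (N + 1) u
    have hl := F.measurable_lmean (N + 1) u
    have hne : ENNReal.ofReal q * ∫⁻ x, F.maxFun N u x ^ (q - 1) * F.lmean N u x ∂μ ≠ ∞ := by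
      refine ENNReal.mul_ne_top ENNReal.ofReal_ne_top (ne_top_of_le_ne_top
        (F.lintegral_maxFun_rpow_lt_top N hu hq.le hfin).ne (lintegral_mono fun x => ?_))
      rw [← rpow_sub_one_mul_self hq.le]
      gcongr
      exact F.lmean_le_maxFun le_rfl u x
    refine (ENNReal.add_le_add_iff_right hne).1 ?_
    calc _ = ∫⁻ x, (ENNReal.ofReal (q - 1) * F.maxFun (N + 1) u x ^ q +
          ENNReal.ofReal q * (F.maxFun N u x ^ (q - 1) * F.lmean (N + 1) u x)) ∂μ := by
          rw [lintegral_add_left (by fun_prop), lintegral_const_mul _ (by fun_prop),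
            lintegral_const_mul _ (by fun_prop), F.lintegral_maxFun_rpow_mul_lmean_succ N hu]
      _ ≤ ∫⁻ x, (ENNReal.ofReal q * (F.maxFun (N + 1) u x ^ (q - 1) * F.lmean (N + 1) u x) +
          ENNReal.ofReal (q - 1) * F.maxFun N u x ^ q) ∂μ := by
          simp only [maxFun_succ]
          exact lintegral_mono fun x => max_rpow_add_le hq _ _
      _ = ENNReal.ofReal q * ∫⁻ x, F.maxFun (N + 1) u x ^ (q - 1) * F.lmean (N + 1) u x ∂μ +
          ENNReal.ofReal (q - 1) * ∫⁻ x, F.maxFun N u x ^ q ∂μ := by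
          rw [lintegral_add_left (by fun_prop), lintegral_const_mul _ (by fun_prop),
            lintegral_const_mul _ (by fun_prop)]
      _ ≤ _ := by gcongr

lemma lintegral_maxFun_rpow_mul_lmean_le (N : ℕ) {u : X → ℝ≥0∞} (hu : Measurable u) {q : ℝ}
    (hq : 1 < q) :
    ∫⁻ x, F.maxFun N u x ^ (q - 1) * F.lmean N u x ∂μ ≤
      (∫⁻ x, u x ^ q ∂μ) ^ q⁻¹ * (∫⁻ x, F.maxFun N u x ^ q ∂μ) ^ (1 - q⁻¹) := by
  have hq0 : 0 < q := by linarith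
  have hm := F.measurable_maxFun N u
  simp only [mul_comm (F.maxFun N u _ ^ (q - 1))]
  rw [F.lintegral_lmean_mul N hu fun x y h => by rw [F.isConst_maxFun N u x y h]]
  calc ∫⁻ x, u x * F.maxFun N u x ^ (q - 1) ∂μ
      = ∫⁻ x, (u x ^ q) ^ q⁻¹ * (F.maxFun N u x ^ q) ^ (1 - q⁻¹) ∂μ := by
        simp only [ENNReal.rpow_rpow_inv hq0.ne', ← ENNReal.rpow_mul, mul_sub,
          mul_inv_cancel₀ hq0.ne', mul_one]
    _ ≤ _ := ENNReal.lintegral_mul_norm_pow_le (by fun_prop) (by fun_prop) (by positivity)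
        (sub_nonneg.2 (inv_le_one_of_one_le₀ hq.le)) (by ring)

theorem lintegral_maxFun_rpow_le (N : ℕ) {u : X → ℝ≥0∞} (hu : Measurable u) {q : ℝ} (hq : 1 < q) :
    ∫⁻ x, F.maxFun N u x ^ q ∂μ ≤ ENNReal.ofReal (q / (q - 1)) ^ q * ∫⁻ x, u x ^ q ∂μ := by
  have hq0 : 0 < q := by linarith
  have hq1 : 0 < q - 1 := by linarith
  rcases eq_or_ne (∫⁻ x, u x ^ q ∂μ) ∞ with htop | hfin
  · have : 0 < q / (q - 1) := by positivity
    rw [htop, ENNReal.mul_top (by simpa [hq0, not_lt.2 hq0.le] using this)]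
    exact le_top
  have hle : ∫⁻ x, F.maxFun N u x ^ q ∂μ ≤ ENNReal.ofReal (q / (q - 1)) *
      ((∫⁻ x, u x ^ q ∂μ) ^ q⁻¹ * (∫⁻ x, F.maxFun N u x ^ q ∂μ) ^ (1 - q⁻¹)) := by
    rw [ENNReal.ofReal_div_of_pos hq1, ← ENNReal.mul_div_right_comm,
      ENNReal.le_div_iff_mul_le (Or.inl (by simpa using hq)) (Or.inl ENNReal.ofReal_ne_top),
      mul_comm]
    exact (F.lintegral_maxFun_rpow_le_mul N hu hq hfin.lt_top).trans
      (mul_le_mul_right (F.lintegral_maxFun_rpow_mul_lmean_le N hu hq) _)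
  simpa using le_rpow_mul_of_le_mul_rpow (inv_pos.2 hq0)
    (F.lintegral_maxFun_rpow_lt_top N hu hq.le hfin.lt_top).ne hle

end CellFiltration

/-! ### Convexity and the `L^p` energy -/

section Convexity

/-- The quadratic gain in the tangent line inequality for `x ↦ x ^ p`, `1 < p ≤ 2`, on `[0, D]`:
half of the minimum of its second derivative there. -/
def convexityConst (p : ℝ) (D : ℝ≥0) : ℝ := p * (p - 1) / 2 * (D : ℝ) ^ (p - 2)

variable {p : ℝ} {D : ℝ≥0}

lemma convexityConst_pos (hp : 1 < p) (hD : 0 < D) : 0 < convexityConst p D := by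
  have : 0 < p * (p - 1) := mul_pos (by linarith) (by linarith)
  have : 0 < (D : ℝ) ^ (p - 2) := Real.rpow_pos_of_pos hD _
  unfold convexityConst
  positivity

lemma convexOn_rpow_sub_mul_sq (hp : 1 < p) (hp2 : p ≤ 2) (B : ℝ) :
    ConvexOn ℝ (Icc 0 B) fun x : ℝ => x ^ p - p * (p - 1) / 2 * B ^ (p - 2) * x ^ 2 := by
  set κ := p * (p - 1) / 2 * B ^ (p - 2) with hκ
  refine convexOn_of_hasDerivWithinAt2_nonneg (f' := fun x => p * x ^ (p - 1) - κ * (2 * x))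
    (f'' := fun x => p * ((p - 1) * x ^ (p - 1 - 1)) - κ * (2 * 1)) (convex_Icc _ _) ?_ ?_ ?_ ?_
  · exact ((Real.continuous_rpow_const (by linarith)).sub (by fun_prop)).continuousOn
  all_goals
    intro x hx
    rw [interior_Icc] at hx
  · refine ((Real.hasDerivAt_rpow_const (Or.inl hx.1.ne')).sub ?_).hasDerivWithinAt
    simpa using (hasDerivAt_pow 2 x).const_mul κ
  · exact (((Real.hasDerivAt_rpow_const (Or.inl hx.1.ne')).const_mul p).sub
      (((hasDerivAt_id x).const_mul 2).const_mul κ)).hasDerivWithinAt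
  · have hpow : B ^ (p - 2) ≤ x ^ (p - 2) :=
      Real.rpow_le_rpow_of_nonpos hx.1 hx.2.le (by linarith)
    have hpp : 0 ≤ p * (p - 1) := mul_nonneg (by linarith) (by linarith)
    rw [show p - 1 - 1 = p - 2 by ring, hκ]
    linarith [mul_le_mul_of_nonneg_left hpow hpp]

lemma add_deriv_mul_sub_le_of_convexOn {s : Set ℝ} {g : ℝ → ℝ} (hg : ConvexOn ℝ s g)
    {c u g' : ℝ} (hc : c ∈ s) (hu : u ∈ s) (hd : HasDerivAt g g' c) : g c + g' * (u - c) ≤ g u := by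
  rcases lt_trichotomy u c with h | rfl | h
  · have := hg.slope_le_of_hasDerivAt hu hc h hd
    rw [slope_def_field, div_le_iff₀ (by linarith)] at this
    linarith
  · simp
  · have := hg.le_slope_of_hasDerivAt hc hu h hd
    rw [slope_def_field, le_div_iff₀ (by linarith)] at this
    linarith

lemma convexityConst_mul_sq_add_le (hp : 1 < p) (hp2 : p ≤ 2) (hD : 1 ≤ D) {c u : ℝ} (hc : 0 < c)
    (hu : 0 ≤ u) (huD : u ≤ D * c) :
    convexityConst p D * ((u - c) ^ 2 * c ^ (p - 2)) + c ^ p + p * (c ^ (p - 1) * u) ≤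
      u ^ p + p * c ^ p := by
  set κ := p * (p - 1) / 2 * (D * c) ^ (p - 2)
  have hd : HasDerivAt (fun x : ℝ => x ^ p - κ * x ^ 2) (p * c ^ (p - 1) - κ * (2 * c)) c :=
    (Real.hasDerivAt_rpow_const (Or.inl hc.ne')).sub
      (by simpa using (hasDerivAt_pow 2 c).const_mul κ)
  have htan : c ^ p - κ * c ^ 2 + (p * c ^ (p - 1) - κ * (2 * c)) * (u - c) ≤
      u ^ p - κ * u ^ 2 :=
    add_deriv_mul_sub_le_of_convexOn (convexOn_rpow_sub_mul_sq hp hp2 (D * c))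
      ⟨hc.le, le_mul_of_one_le_left hc.le hD⟩ ⟨hu, huD⟩ hd
  have hκ : convexityConst p D * ((u - c) ^ 2 * c ^ (p - 2)) = κ * (u - c) ^ 2 := by
    simp only [κ, convexityConst, Real.mul_rpow D.coe_nonneg hc.le]
    ring
  have hcp : c ^ (p - 1) * c = c ^ p := by
    rw [← Real.rpow_add_one hc.ne', sub_add_cancel]
  rw [hκ, ← hcp]
  rw [← hcp] at htan
  linarith

end Convexity

namespace CellFiltration

variable {X : Type*} [MeasurableSpace X] {μ : Measure X} {ι : Type*} [MeasurableSpace ι] {D : ℝ≥0}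
  (F : CellFiltration μ ι D) {f : X → ℝ}

lemma mean_nonneg (k : ℕ) (h0 : ∀ x, 0 ≤ f x) (x : X) : 0 ≤ F.mean k f x :=
  integral_nonneg h0

lemma enorm_mean (k : ℕ) (hf : Integrable f μ) (h0 : ∀ x, 0 ≤ f x) (x : X) :
    ‖F.mean k f x‖ₑ = F.lmean k (‖f ·‖ₑ) x := by
  simp only [Real.enorm_of_nonneg (h0 _), Real.enorm_of_nonneg (F.mean_nonneg k h0 x)]
  rw [mean, lmean, ofReal_setAverage hf.integrableOn (ae_of_all _ h0), setLAverage_eq]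

lemma lmean_succ_le (k : ℕ) (u : X → ℝ≥0∞) (x : X) :
    F.lmean (k + 1) u x ≤ D * F.lmean k u x := by
  refine (ENNReal.mul_le_mul_iff_right (F.measure_ne_zero (k + 1) x)
    (F.measure_ne_top (k + 1) x)).1 ?_
  calc _ = ∫⁻ y in F.cell (k + 1) x, u y ∂μ := F.measure_mul_lmean (k + 1) u x
    _ ≤ ∫⁻ y in F.cell k x, u y ∂μ := lintegral_mono_set (F.cell_subset_of_le k.le_succ x)
    _ = μ (F.cell k x) * F.lmean k u x := (F.measure_mul_lmean k u x).symm
    _ ≤ (D * μ (F.cell (k + 1) x)) * F.lmean k u x := by gcongr; exact F.doubling k x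
    _ = _ := by rw [cell]; ring

lemma mean_succ_le (k : ℕ) (hf : Integrable f μ) (h0 : ∀ x, 0 ≤ f x) (x : X) :
    F.mean (k + 1) f x ≤ D * F.mean k f x := by
  have h := F.lmean_succ_le k (‖f ·‖ₑ) x
  rw [← F.enorm_mean _ hf h0, ← F.enorm_mean _ hf h0, Real.enorm_of_nonneg (F.mean_nonneg _ h0 x),
    Real.enorm_of_nonneg (F.mean_nonneg _ h0 x), ← ENNReal.ofReal_coe_nnreal,
    ← ENNReal.ofReal_mul (by positivity)] at h
  exact (ENNReal.ofReal_le_ofReal_iff (mul_nonneg D.2 (F.mean_nonneg k h0 x))).1 h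

/-- The density of the `L^p` energy between generations `k` and `k + 1`: the term
`|Δ_k f|² (𝔼_k |f|)^(p - 2)` of the second-order expansion of `(𝔼_{k+1} f) ^ p` at `𝔼_k f`. -/
def energy (p : ℝ) (k : ℕ) (f : X → ℝ) (x : X) : ℝ≥0∞ :=
  ‖F.diff k f x‖ₑ ^ 2 * F.lmean k (‖f ·‖ₑ) x ^ (p - 2)

variable {p : ℝ} (hp : 1 < p) (hp2 : p ≤ 2)
include hp hp2

lemma convexityConst_mul_energy_add_le (k : ℕ) (hf : Integrable f μ) (h0 : ∀ x, 0 ≤ f x) (x : X) :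
    ENNReal.ofReal (convexityConst p D) * F.energy p k f x + F.lmean k (‖f ·‖ₑ) x ^ p +
      ENNReal.ofReal p * (F.lmean k (‖f ·‖ₑ) x ^ (p - 1) * F.lmean (k + 1) (‖f ·‖ₑ) x) ≤
    F.lmean (k + 1) (‖f ·‖ₑ) x ^ p + ENNReal.ofReal p * F.lmean k (‖f ·‖ₑ) x ^ p := by
  have : Nonempty X := ⟨x⟩
  have hu := F.mean_nonneg (k + 1) h0 x
  have hle := F.mean_succ_le k hf h0 x
  have hκ := convexityConst_pos hp (zero_lt_one.trans_le F.one_le)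
  rw [energy, ← F.enorm_mean _ hf h0, ← F.enorm_mean _ hf h0]
  rcases (F.mean_nonneg k h0 x).eq_or_lt with hc | hc
  · have hsucc : F.mean (k + 1) f x = 0 :=
      le_antisymm (hle.trans_eq (by rw [← hc, mul_zero])) hu
    simp [diff, hsucc, ← hc, ENNReal.zero_rpow_of_pos (zero_lt_one.trans hp)]
  · rw [diff, ← enorm_pow, Real.enorm_of_nonneg (sq_nonneg _), Real.enorm_of_nonneg hu,
      Real.enorm_of_nonneg hc.le, ENNReal.ofReal_rpow_of_pos hc, ENNReal.ofReal_rpow_of_pos hc,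
      ENNReal.ofReal_rpow_of_pos hc, ENNReal.ofReal_rpow_of_nonneg hu (by linarith),
      ← ENNReal.ofReal_mul (by positivity), ← ENNReal.ofReal_mul (by positivity),
      ← ENNReal.ofReal_mul (by positivity), ← ENNReal.ofReal_mul (by positivity),
      ← ENNReal.ofReal_mul (by positivity), ← ENNReal.ofReal_add (by positivity) (by positivity),
      ← ENNReal.ofReal_add (by positivity) (by positivity),
      ← ENNReal.ofReal_add (by positivity) (by positivity)]
    exact ENNReal.ofReal_le_ofReal (convexityConst_mul_sq_add_le hp hp2 F.one_le hc hu hle)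

omit hp hp2
variable [Countable ι] [MeasurableSingletonClass ι]

lemma measurable_energy (k : ℕ) (f : X → ℝ) : Measurable (F.energy p k f) := by
  have := F.measurable_diff k f
  have := F.measurable_lmean k (‖f ·‖ₑ)
  unfold energy
  fun_prop

lemma setLIntegral_lmean_of_le {j k : ℕ} (hjk : j ≤ k) {u : X → ℝ≥0∞} (hu : Measurable u) (x : X) :
    ∫⁻ y in F.cell j x, F.lmean k u y ∂μ = ∫⁻ y in F.cell j x, u y ∂μ := by
  have hc : F.IsConst j ((F.cell j x).indicator (1 : X → ℝ≥0∞)) := fun y z h => by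
    have hyz : y ∈ F.cell j x ↔ z ∈ F.cell j x := by simp only [cell, mem_ofPred_eq, h]
    by_cases hz : z ∈ F.cell j x
    · simp only [indicator_of_mem hz, indicator_of_mem (hyz.2 hz), Pi.one_apply]
    · simp only [indicator_of_notMem hz, indicator_of_notMem (mt hyz.1 hz)]
  have := F.lintegral_lmean_mul k hu (hc.mono hjk)
  simpa only [← indicator_mul_right, Pi.one_apply, mul_one,
    lintegral_indicator (F.measurableSet_cell j x)] using this

include hp hp2

-- The first order term of the convexity inequality integrates to zero by the martingale property.
lemma setLIntegral_energy_add_le (k : ℕ) (hfm : Measurable f) (hf : Integrable f μ)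
    (h0 : ∀ x, 0 ≤ f x) (x : X) :
    ENNReal.ofReal (convexityConst p D) * (∫⁻ y in F.cell k x, F.energy p k f y ∂μ) +
      ∫⁻ y in F.cell k x, F.lmean k (‖f ·‖ₑ) y ^ p ∂μ ≤
    ∫⁻ y in F.cell k x, F.lmean (k + 1) (‖f ·‖ₑ) y ^ p ∂μ := by
  set U := fun y => ‖f y‖ₑ
  have hm := F.measurable_lmean k U
  have hm' := F.measurable_lmean (k + 1) U
  have he := F.measurable_energy (p := p) k f
  have hpow (s : ℝ) : F.IsConst k fun y => F.lmean k U y ^ s := fun y z h => by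
    simp only [F.isConst_lmean k U y z h]
  have hcross : ∫⁻ y in F.cell k x, F.lmean k U y ^ (p - 1) * F.lmean (k + 1) U y ∂μ =
      ∫⁻ y in F.cell k x, F.lmean k U y ^ p ∂μ := by
    simp only [← rpow_sub_one_mul_self hp.le, mul_comm (F.lmean k U _ ^ (p - 1))]
    rw [F.setLIntegral_mul_isConst hm' (hpow _), F.setLIntegral_mul_isConst hm (hpow _),
      F.setLIntegral_lmean_of_le k.le_succ hfm.enorm, F.setLIntegral_lmean]
  have hne : ENNReal.ofReal p * ∫⁻ y in F.cell k x, F.lmean k U y ^ p ∂μ ≠ ∞ := by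
    rw [F.setLIntegral_isConst (hpow p), ← F.enorm_mean k hf h0]
    exact ENNReal.mul_ne_top ENNReal.ofReal_ne_top (ENNReal.mul_ne_top
      (ENNReal.rpow_ne_top_of_nonneg (by linarith) enorm_ne_top) (F.measure_ne_top k x))
  refine (ENNReal.add_le_add_iff_right hne).1 ?_
  calc _ = ∫⁻ y in F.cell k x, (ENNReal.ofReal (convexityConst p D) * F.energy p k f y +
        F.lmean k U y ^ p + ENNReal.ofReal p * (F.lmean k U y ^ (p - 1) *
           F.lmean (k + 1) U y)) ∂μ := by
        rw [lintegral_add_left (by fun_prop), lintegral_add_left (by fun_prop),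
          lintegral_const_mul _ (by fun_prop), lintegral_const_mul _ (by fun_prop), hcross]
    _ ≤ ∫⁻ y in F.cell k x, (F.lmean (k + 1) U y ^ p + ENNReal.ofReal p * F.lmean k U y ^ p) ∂μ :=
        lintegral_mono fun y => F.convexityConst_mul_energy_add_le hp hp2 k hf h0 y
    _ = _ := by rw [lintegral_add_left (by fun_prop), lintegral_const_mul _ (by fun_prop)]

lemma lintegral_energy_mul_add_le (k : ℕ) (hfm : Measurable f) (hf : Integrable f μ)
    (h0 : ∀ x, 0 ≤ f x) {W : X → ℝ≥0∞} (hW : F.IsConst k W) :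
    ENNReal.ofReal (convexityConst p D) * (∫⁻ y, F.energy p k f y * W y ∂μ) +
      ∫⁻ y, F.lmean k (‖f ·‖ₑ) y ^ p * W y ∂μ ≤
    ∫⁻ y, F.lmean (k + 1) (‖f ·‖ₑ) y ^ p * W y ∂μ := by
  have hm := F.measurable_lmean k (‖f ·‖ₑ)
  have hm' := F.measurable_lmean (k + 1) (‖f ·‖ₑ)
  have he := F.measurable_energy (p := p) k f
  have hWm := hW.measurable
  rw [← lintegral_const_mul _ (by fun_prop), ← lintegral_add_left (by fun_prop)]
  refine F.lintegral_le_of_cells k fun x => ?_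
  simp only [← mul_assoc, ← add_mul]
  rw [F.setLIntegral_mul_isConst (by fun_prop) hW, F.setLIntegral_mul_isConst (by fun_prop) hW,
    lintegral_add_left (by fun_prop), lintegral_const_mul _ (by fun_prop)]
  gcongr
  exact F.setLIntegral_energy_add_le hp hp2 k hfm hf h0 x

lemma sum_lintegral_energy_mul_le (hfm : Measurable f) (hf : Integrable f μ) (h0 : ∀ x, 0 ≤ f x)
    {W : ℕ → X → ℝ≥0∞} (hW : ∀ k, F.IsConst k (W k)) (hmono : ∀ k x, W k x ≤ W (k + 1) x) (N : ℕ) :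
    ENNReal.ofReal (convexityConst p D) *
        ∑ k ∈ Finset.range N, ∫⁻ y, F.energy p k f y * W k y ∂μ ≤
      ∫⁻ y, ‖f y‖ₑ ^ p * W N y ∂μ := by
  have key : ENNReal.ofReal (convexityConst p D) *
      ∑ k ∈ Finset.range N, ∫⁻ y, F.energy p k f y * W k y ∂μ ≤
        ∫⁻ y, F.lmean N (‖f ·‖ₑ) y ^ p * W N y ∂μ := by
    induction N with
    | zero => simp
    | succ N ih =>
      rw [Finset.sum_range_succ, mul_add, add_comm]
      calc _ ≤ ENNReal.ofReal (convexityConst p D) * (∫⁻ y, F.energy p N f y * W N y ∂μ) +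
            ∫⁻ y, F.lmean N (‖f ·‖ₑ) y ^ p * W N y ∂μ := by gcongr
        _ ≤ _ := F.lintegral_energy_mul_add_le hp hp2 N hfm hf h0 (hW N)
        _ ≤ _ := by gcongr with y; exact hmono N y
  refine key.trans ?_
  rw [← F.lintegral_lmean_mul N (hfm.enorm.pow_const p) (hW N)]
  gcongr with y
  exact F.rpow_lmean_le N hfm.enorm hp.le y

end CellFiltration

/-! ### Martingale square functions -/

namespace CellFiltration

variable {X : Type*} [MeasurableSpace X] {μ : Measure X} {ι : Type*} [MeasurableSpace ι] {D : ℝ≥0}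
  (F : CellFiltration μ ι D) {f : X → ℝ} {p : ℝ}

lemma enorm_diff_le (k : ℕ) (hf : Integrable f μ) (h0 : ∀ x, 0 ≤ f x) (x : X) :
    ‖F.diff k f x‖ₑ ≤ F.lmean (k + 1) (‖f ·‖ₑ) x + F.lmean k (‖f ·‖ₑ) x := by
  rw [← F.enorm_mean _ hf h0, ← F.enorm_mean _ hf h0]
  exact enorm_sub_le

lemma enorm_diff_le_energy_mul (p : ℝ) (k : ℕ) (hf : Integrable f μ) (h0 : ∀ x, 0 ≤ f x) (x : X) :
    ‖F.diff k f x‖ₑ ≤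
      F.energy p k f x ^ (1 / 2 : ℝ) * (F.lmean k (‖f ·‖ₑ) x ^ (2 - p)) ^ (1 / 2 : ℝ) := by
  rw [energy, ← F.enorm_mean _ hf h0]
  rcases eq_or_ne (F.mean k f x) 0 with hc | hc
  · have hsucc : F.mean (k + 1) f x = 0 :=
      le_antisymm ((F.mean_succ_le k hf h0 x).trans_eq (by rw [hc, mul_zero]))
        (F.mean_nonneg (k + 1) h0 x)
    simp [diff, hsucc, hc]
  · rw [← ENNReal.mul_rpow_of_nonneg _ _ (by norm_num), mul_assoc,
      ← ENNReal.rpow_add _ _ (enorm_ne_zero.2 hc) enorm_ne_top, sub_add_sub_cancel', sub_self,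
      ENNReal.rpow_zero, mul_one, ← ENNReal.rpow_two, one_div,
      ENNReal.rpow_rpow_inv two_ne_zero]

/-- The square of the average, over cells of generation `k`, of the martingale difference `m`
generations below. -/
def shiftSq (m : ℕ) (f : X → ℝ) (k : ℕ) (x : X) : ℝ≥0∞ := F.lmean k (‖F.diff (k + m) f ·‖ₑ) x ^ 2

variable [Countable ι] [MeasurableSingletonClass ι]

lemma measurable_shiftSq (m : ℕ) (f : X → ℝ) (k : ℕ) : Measurable (F.shiftSq m f k) :=
  (F.measurable_lmean _ _).pow_const 2

lemma lmean_lmean {j k : ℕ} (hjk : j ≤ k) {u : X → ℝ≥0∞} (hu : Measurable u) (x : X) :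
    F.lmean j (F.lmean k u) x = F.lmean j u x := by
  rw [lmean, setLAverage_eq, F.setLIntegral_lmean_of_le hjk hu, lmean, setLAverage_eq]

section LeTwo

lemma shiftSq_le_lmean_energy_mul (hp : 1 ≤ p) (hp2 : p ≤ 2) (m : ℕ) (hfm : Measurable f)
    (hf : Integrable f μ) (h0 : ∀ x, 0 ≤ f x) (k : ℕ) (x : X) :
    F.shiftSq m f k x ≤
      F.lmean k (F.energy p (k + m) f) x * F.lmean k (‖f ·‖ₑ) x ^ (2 - p) := by
  have hm := F.measurable_lmean (k + m) (‖f ·‖ₑ)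
  have hdiff : F.lmean k (‖F.diff (k + m) f ·‖ₑ) x ≤
      F.lmean k (F.energy p (k + m) f) x ^ (1 / 2 : ℝ) *
        F.lmean k (fun y => F.lmean (k + m) (‖f ·‖ₑ) y ^ (2 - p)) x ^ (1 / 2 : ℝ) :=
    (F.lmean_mono (F.enorm_diff_le_energy_mul p (k + m) hf h0)).trans
      (F.lmean_mul_rpow_le k (F.measurable_energy _ f) (by fun_prop) x)
  have hjensen : F.lmean k (fun y => F.lmean (k + m) (‖f ·‖ₑ) y ^ (2 - p)) x ≤
      F.lmean k (‖f ·‖ₑ) x ^ (2 - p) := by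
    rw [← F.lmean_lmean (Nat.le_add_right k m) hfm.enorm]
    exact F.lmean_rpow_le k hm (by linarith) (by linarith) x
  have hhalf (a : ℝ≥0∞) : (a ^ (1 / 2 : ℝ)) ^ 2 = a := by
    rw [← ENNReal.rpow_two, one_div, ENNReal.rpow_inv_rpow two_ne_zero]
  calc F.shiftSq m f k x ≤ _ := pow_le_pow_left₀ zero_le hdiff 2
    _ = F.lmean k (F.energy p (k + m) f) x *
          F.lmean k (fun y => F.lmean (k + m) (‖f ·‖ₑ) y ^ (2 - p)) x := by
      rw [mul_pow, hhalf, hhalf]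
    _ ≤ _ := by gcongr

lemma lintegral_sum_lmean_energy_le (hD : 0 < D) (hp : 1 < p) (hp2 : p ≤ 2) (m : ℕ)
    (hfm : Measurable f) (hf : Integrable f μ) (h0 : ∀ x, 0 ≤ f x) (N : ℕ) :
    ∫⁻ x, ∑ k ∈ Finset.range N, F.lmean k (F.energy p (k + m) f) x ∂μ ≤
      (ENNReal.ofReal (convexityConst p D))⁻¹ * ∫⁻ x, ‖f x‖ₑ ^ p ∂μ := by
  have hκ : ENNReal.ofReal (convexityConst p D) ≠ 0 := by
    simpa using convexityConst_pos hp hD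
  have hsum := F.sum_lintegral_energy_mul_le hp hp2 hfm hf h0 (W := fun _ _ => 1)
    (fun _ _ _ _ => rfl) (fun _ _ => le_rfl) (N + m)
  simp only [mul_one] at hsum
  rw [lintegral_finsetSum _ fun k _ => F.measurable_lmean _ _]
  simp only [F.lintegral_lmean _ (F.measurable_energy _ f)]
  refine (sum_range_add_le (fun k => ∫⁻ y, F.energy p k f y ∂μ) m N).trans ?_
  rwa [mul_comm, ← div_eq_mul_inv, ENNReal.le_div_iff_mul_le (Or.inl hκ)
    (Or.inl ENNReal.ofReal_ne_top), mul_comm]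

lemma sum_shiftSq_rpow_le (hp : 1 ≤ p) (hp2 : p ≤ 2) (m : ℕ) (hfm : Measurable f)
    (hf : Integrable f μ) (h0 : ∀ x, 0 ≤ f x) (N : ℕ) (x : X) :
    (∑ k ∈ Finset.range N, F.shiftSq m f k x) ^ (p / 2) ≤
      (∑ k ∈ Finset.range N, F.lmean k (F.energy p (k + m) f) x) ^ (p / 2) *
        (F.maxFun N (‖f ·‖ₑ) x ^ p) ^ (1 - p / 2) := by
  calc (∑ k ∈ Finset.range N, F.shiftSq m f k x) ^ (p / 2)
      ≤ ((∑ k ∈ Finset.range N, F.lmean k (F.energy p (k + m) f) x) *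
          F.maxFun N (‖f ·‖ₑ) x ^ (2 - p)) ^ (p / 2) := by
        refine ENNReal.rpow_le_rpow ?_ (by linarith)
        rw [Finset.sum_mul]
        refine Finset.sum_le_sum fun k hk =>
          (F.shiftSq_le_lmean_energy_mul hp hp2 m hfm hf h0 k x).trans ?_
        gcongr
        exact F.lmean_le_maxFun (Finset.mem_range.1 hk).le _ x
    _ = _ := by
        rw [ENNReal.mul_rpow_of_nonneg _ _ (by linarith), ← ENNReal.rpow_mul, ← ENNReal.rpow_mul]
        congr 2
        ring

lemma lintegral_sum_shiftSq_rpow_le_of_le_two (hD : 0 < D) (hp : 1 < p) (hp2 : p ≤ 2) (m : ℕ)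
    (hfm : Measurable f) (hf : Integrable f μ) (h0 : ∀ x, 0 ≤ f x) (N : ℕ) :
    ∫⁻ x, (∑ k ∈ Finset.range N, F.shiftSq m f k x) ^ (p / 2) ∂μ ≤
      ((ENNReal.ofReal (convexityConst p D))⁻¹ ^ (p / 2) *
        (ENNReal.ofReal (p / (p - 1)) ^ p) ^ (1 - p / 2)) * ∫⁻ x, ‖f x‖ₑ ^ p ∂μ := by
  have hM := F.measurable_maxFun N (‖f ·‖ₑ)
  have hL (k : ℕ) := F.measurable_lmean k (F.energy p (k + m) f)
  have hp0 : 0 ≤ p / 2 := by linarith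
  have hp1 : 0 ≤ 1 - p / 2 := by linarith
  calc _ ≤ _ := lintegral_mono (F.sum_shiftSq_rpow_le hp.le hp2 m hfm hf h0 N)
    _ ≤ (∫⁻ x, ∑ k ∈ Finset.range N, F.lmean k (F.energy p (k + m) f) x ∂μ) ^ (p / 2) *
        (∫⁻ x, F.maxFun N (‖f ·‖ₑ) x ^ p ∂μ) ^ (1 - p / 2) :=
        ENNReal.lintegral_mul_norm_pow_le (by fun_prop) (by fun_prop) hp0 hp1 (by ring)
    _ ≤ ((ENNReal.ofReal (convexityConst p D))⁻¹ * ∫⁻ x, ‖f x‖ₑ ^ p ∂μ) ^ (p / 2) *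
        (ENNReal.ofReal (p / (p - 1)) ^ p * ∫⁻ x, ‖f x‖ₑ ^ p ∂μ) ^ (1 - p / 2) := by
        gcongr
        · exact F.lintegral_sum_lmean_energy_le hD hp hp2 m hfm hf h0 N
        · exact F.lintegral_maxFun_rpow_le N hfm.enorm hp
    _ = ((ENNReal.ofReal (convexityConst p D))⁻¹ ^ (p / 2) *
          (ENNReal.ofReal (p / (p - 1)) ^ p) ^ (1 - p / 2)) *
        ((∫⁻ x, ‖f x‖ₑ ^ p ∂μ) ^ (p / 2) * (∫⁻ x, ‖f x‖ₑ ^ p ∂μ) ^ (1 - p / 2)) := by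
        rw [ENNReal.mul_rpow_of_nonneg _ _ hp0, ENNReal.mul_rpow_of_nonneg _ _ hp1]
        ring
    _ = _ := by
        rw [← ENNReal.rpow_add_of_nonneg _ _ hp0 hp1, add_sub_cancel, ENNReal.rpow_one]

end LeTwo

section TwoLt

lemma lintegral_shiftSq_rpow_lt_top (hp : 1 ≤ p) (m k : ℕ) (hfm : Measurable f)
    (hf : Integrable f μ) (h0 : ∀ x, 0 ≤ f x) (hfin : ∫⁻ x, ‖f x‖ₑ ^ p ∂μ < ∞) :
    ∫⁻ x, F.shiftSq m f k x ^ (p / 2) ∂μ < ∞ := by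
  have hlt (k : ℕ) : ∫⁻ x, F.lmean k (‖f ·‖ₑ) x ^ p ∂μ < ∞ :=
    (F.lintegral_lmean_rpow_le k hfm.enorm hp).trans_lt hfin
  calc _ = ∫⁻ x, F.lmean k (‖F.diff (k + m) f ·‖ₑ) x ^ p ∂μ := by
        simp only [shiftSq, ← ENNReal.rpow_two, ← ENNReal.rpow_mul, mul_div_cancel₀ p two_ne_zero]
    _ ≤ ∫⁻ x, ‖F.diff (k + m) f x‖ₑ ^ p ∂μ :=
        F.lintegral_lmean_rpow_le k (F.measurable_diff _ f).enorm hp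
    _ ≤ ∫⁻ x, (F.lmean (k + m + 1) (‖f ·‖ₑ) + F.lmean (k + m) (‖f ·‖ₑ)) x ^ p ∂μ :=
        lintegral_mono fun x => ENNReal.rpow_le_rpow (F.enorm_diff_le (k + m) hf h0 x) (by linarith)
    _ < ∞ := ENNReal.lintegral_rpow_add_lt_top_of_lintegral_rpow_lt_top
        (F.measurable_lmean _ _).aemeasurable (hlt _) (hlt _) hp

lemma lintegral_sum_shiftSq_rpow_lt_top (hp : 2 ≤ p) (m : ℕ) (hfm : Measurable f)
    (hf : Integrable f μ) (h0 : ∀ x, 0 ≤ f x) (hfin : ∫⁻ x, ‖f x‖ₑ ^ p ∂μ < ∞) (N : ℕ) :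
    ∫⁻ x, (∑ k ∈ Finset.range N, F.shiftSq m f k x) ^ (p / 2) ∂μ < ∞ := by
  have hs := F.measurable_shiftSq m f
  induction N with
  | zero => simp [show 0 < p / 2 by linarith]
  | succ N ih =>
    simp only [Finset.sum_range_succ]
    exact ENNReal.lintegral_rpow_add_lt_top_of_lintegral_rpow_lt_top
      (f := fun x => ∑ k ∈ Finset.range N, F.shiftSq m f k x) (by fun_prop) ih
      (F.lintegral_shiftSq_rpow_lt_top (by linarith) m N hfm hf h0 hfin) (by linarith)

lemma lintegral_shiftSq_mul_le (m : ℕ) (f : X → ℝ) (k : ℕ) {w : X → ℝ≥0∞} (hw : Measurable w) :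
    ∫⁻ x, F.shiftSq m f k x * w x ∂μ ≤
      ∫⁻ x, F.energy 2 (k + m) f x * F.maxFun (k + m) w x ∂μ := by
  have hd := F.measurable_diff (k + m) f
  calc _ ≤ ∫⁻ x, F.lmean k (fun y => ‖F.diff (k + m) f y‖ₑ ^ 2) x * w x ∂μ := by
        gcongr with x
        simpa only [ENNReal.rpow_two, shiftSq] using F.rpow_lmean_le k hd.enorm one_le_two x
    _ = ∫⁻ x, ‖F.diff (k + m) f x‖ₑ ^ 2 * F.lmean k w x ∂μ :=
        F.lintegral_lmean_mul_comm k (by fun_prop) hw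
    _ ≤ _ := by
        simp only [energy, sub_self, ENNReal.rpow_zero, mul_one]
        gcongr with x
        exact F.lmean_le_maxFun (Nat.le_add_right k m) w x

lemma lintegral_sum_shiftSq_mul_le (m : ℕ) (hfm : Measurable f) (hf : Integrable f μ)
    (h0 : ∀ x, 0 ≤ f x) (N : ℕ) {w : X → ℝ≥0∞} (hw : Measurable w) :
    ∫⁻ x, (∑ k ∈ Finset.range N, F.shiftSq m f k x) * w x ∂μ ≤
      ∫⁻ x, ‖f x‖ₑ ^ (2 : ℝ) * F.maxFun (N + m) w x ∂μ := by
  have hs := F.measurable_shiftSq m f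
  have hκ : convexityConst 2 D = 1 := by norm_num [convexityConst]
  have henergy := F.sum_lintegral_energy_mul_le one_lt_two le_rfl hfm hf h0 (F.isConst_maxFun · w)
    (fun k x => F.maxFun_mono k.le_succ w x) (N + m)
  rw [hκ, ENNReal.ofReal_one, one_mul] at henergy
  simp only [Finset.sum_mul]
  rw [lintegral_finsetSum _ fun k _ => by fun_prop]
  exact (Finset.sum_le_sum fun k _ => F.lintegral_shiftSq_mul_le m f k hw).trans
    ((sum_range_add_le (fun k => ∫⁻ x, F.energy 2 k f x * F.maxFun k w x ∂μ) m N).trans henergy)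

lemma lintegral_maxFun_rpow_half_sub_one_le (hp : 2 < p) (N : ℕ) {u : X → ℝ≥0∞}
    (hu : Measurable u) :
    ∫⁻ x, F.maxFun N (fun y => u y ^ (p / 2 - 1)) x ^ (p / (p - 2)) ∂μ ≤
      ENNReal.ofReal (p / 2) ^ (p / (p - 2)) * ∫⁻ x, u x ^ (p / 2) ∂μ := by
  have hp2 : 0 < p - 2 := by linarith
  have hq : p / (p - 2) / (p / (p - 2) - 1) = p / 2 := by field_simp; ring
  have hexp : (p / 2 - 1) * (p / (p - 2)) = p / 2 := by field_simp
  have h := F.lintegral_maxFun_rpow_le N (u := fun x => u x ^ (p / 2 - 1)) (by fun_prop)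
    (show 1 < p / (p - 2) by rw [lt_div_iff₀ hp2]; linarith)
  simpa only [hq, ← ENNReal.rpow_mul, hexp] using h

-- Duality: the square sum `H` is paired with `H ^ (p / 2 - 1)`, whose maximal function is bounded
-- on `L^(p / (p - 2))`.
lemma lintegral_sum_shiftSq_rpow_le_of_two_lt (hp : 2 < p) (m : ℕ) (hfm : Measurable f)
    (hf : Integrable f μ) (h0 : ∀ x, 0 ≤ f x) (hfin : ∫⁻ x, ‖f x‖ₑ ^ p ∂μ < ∞) (N : ℕ) :
    ∫⁻ x, (∑ k ∈ Finset.range N, F.shiftSq m f k x) ^ (p / 2) ∂μ ≤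
      ENNReal.ofReal (p / 2) ^ (p / 2) * ∫⁻ x, ‖f x‖ₑ ^ p ∂μ := by
  have hs := F.measurable_shiftSq m f
  have hp2 : 0 < p - 2 := by linarith
  have hs1 : 0 ≤ 1 - 2 / p := by rw [sub_nonneg, div_le_one (by linarith)]; exact hp.le
  set H : X → ℝ≥0∞ := fun x => ∑ k ∈ Finset.range N, F.shiftSq m f k x
  set M := F.maxFun (N + m) fun x => H x ^ (p / 2 - 1)
  have hM : Measurable M := F.measurable_maxFun _ _
  have hmax : ∫⁻ x, M x ^ (p / (p - 2)) ∂μ ≤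
      ENNReal.ofReal (p / 2) ^ (p / (p - 2)) * ∫⁻ x, H x ^ (p / 2) ∂μ :=
    F.lintegral_maxFun_rpow_half_sub_one_le hp (N + m) (by fun_prop)
  have hconj : p / (p - 2) * (1 - 2 / p) = 1 := by field_simp
  have hle : ∫⁻ x, H x ^ (p / 2) ∂μ ≤ ENNReal.ofReal (p / 2) *
      ((∫⁻ x, ‖f x‖ₑ ^ p ∂μ) ^ (2 / p) * (∫⁻ x, H x ^ (p / 2) ∂μ) ^ (1 - 2 / p)) := by
    calc ∫⁻ x, H x ^ (p / 2) ∂μ = ∫⁻ x, H x * H x ^ (p / 2 - 1) ∂μ := by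
          simp only [mul_comm (H _), rpow_sub_one_mul_self (by linarith : 1 ≤ p / 2)]
      _ ≤ ∫⁻ x, ‖f x‖ₑ ^ (2 : ℝ) * M x ∂μ :=
          F.lintegral_sum_shiftSq_mul_le m hfm hf h0 N (by fun_prop)
      _ = ∫⁻ x, (‖f x‖ₑ ^ p) ^ (2 / p) * (M x ^ (p / (p - 2))) ^ (1 - 2 / p) ∂μ := by
          simp only [← ENNReal.rpow_mul, hconj, ENNReal.rpow_one,
            mul_div_cancel₀ (2 : ℝ) (by linarith : p ≠ 0)]
      _ ≤ (∫⁻ x, ‖f x‖ₑ ^ p ∂μ) ^ (2 / p) * (∫⁻ x, M x ^ (p / (p - 2)) ∂μ) ^ (1 - 2 / p) :=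
          ENNReal.lintegral_mul_norm_pow_le (by fun_prop) (by fun_prop) (by positivity) hs1
            (by ring)
      _ ≤ (∫⁻ x, ‖f x‖ₑ ^ p ∂μ) ^ (2 / p) * (ENNReal.ofReal (p / 2) ^ (p / (p - 2)) *
            ∫⁻ x, H x ^ (p / 2) ∂μ) ^ (1 - 2 / p) := by gcongr
      _ = _ := by
          rw [ENNReal.mul_rpow_of_nonneg _ _ hs1, ← ENNReal.rpow_mul, hconj, ENNReal.rpow_one]
          ring
  simpa using le_rpow_mul_of_le_mul_rpow (by positivity)
    (F.lintegral_sum_shiftSq_rpow_lt_top hp.le m hfm hf h0 hfin N).ne hle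

end TwoLt

variable (μ ι) in
lemma exists_lintegral_sum_shiftSq_rpow_le (hD : 0 < D) (hp : 1 < p) :
    ∃ C : ℝ≥0, ∀ (F : CellFiltration μ ι D) (m N : ℕ) (f : X → ℝ), Measurable f →
      Integrable f μ → (∀ x, 0 ≤ f x) → ∫⁻ x, ‖f x‖ₑ ^ p ∂μ < ∞ →
        ∫⁻ x, (∑ k ∈ Finset.range N, F.shiftSq m f k x) ^ (p / 2) ∂μ ≤
          C * ∫⁻ x, ‖f x‖ₑ ^ p ∂μ := by
  rcases le_or_gt p 2 with hp2 | hp2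
  · have hκ : ENNReal.ofReal (convexityConst p D) ≠ 0 := by
      simpa using convexityConst_pos hp hD
    lift (ENNReal.ofReal (convexityConst p D))⁻¹ ^ (p / 2) *
      (ENNReal.ofReal (p / (p - 1)) ^ p) ^ (1 - p / 2) to ℝ≥0 using ENNReal.mul_ne_top
        (ENNReal.rpow_ne_top_of_nonneg (by linarith) (ENNReal.inv_ne_top.2 hκ))
        (ENNReal.rpow_ne_top_of_nonneg (by linarith)
          (ENNReal.rpow_ne_top_of_nonneg (by linarith) ENNReal.ofReal_ne_top)) with C hC
    refine ⟨C, fun F m N f hfm hf h0 _ => ?_⟩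
    rw [hC]
    exact F.lintegral_sum_shiftSq_rpow_le_of_le_two hD hp hp2 m hfm hf h0 N
  · lift ENNReal.ofReal (p / 2) ^ (p / 2) to ℝ≥0 using
      ENNReal.rpow_ne_top_of_nonneg (by linarith) ENNReal.ofReal_ne_top with C hC
    refine ⟨C, fun F m N f hfm hf h0 hfin => ?_⟩
    rw [hC]
    exact F.lintegral_sum_shiftSq_rpow_le_of_two_lt hp2 m hfm hf h0 hfin N

lemma lintegral_tsum_shiftSq_rpow_le_of_sum (hp : 0 ≤ p) {m : ℕ} {B : ℝ≥0∞}
    (h : ∀ N, ∫⁻ x, (∑ k ∈ Finset.range N, F.shiftSq m f k x) ^ p ∂μ ≤ B) :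
    ∫⁻ x, (∑' k, F.shiftSq m f k x) ^ p ∂μ ≤ B := by
  have hs := F.measurable_shiftSq m f
  have hlim := lintegral_tendsto_of_tendsto_of_monotone (μ := μ)
    (f := fun N x => (∑ k ∈ Finset.range N, F.shiftSq m f k x) ^ p)
    (F := fun x => (∑' k, F.shiftSq m f k x) ^ p) (fun N => by fun_prop)
    (ae_of_all _ fun x M N hMN => ENNReal.rpow_le_rpow (Finset.sum_le_sum_of_subset
      (Finset.range_mono hMN)) hp)
    (ae_of_all _ fun x => (ENNReal.continuous_rpow_const.tendsto _).comp
      ENNReal.summable.hasSum.tendsto_sum_nat)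
  exact le_of_tendsto' hlim h

/-- The square function `∑ₖ (∑ₘ τ^(2m) 𝔼ₖ|Δ_{k+m} f|)²`: the sum over generations of the squared
averages of the finer martingale differences, damped geometrically in the depth. -/
def geomSq (τ : ℝ≥0∞) (f : X → ℝ) (x : X) : ℝ≥0∞ :=
  ∑' k, (∑' m, τ ^ (2 * m) * F.lmean k (‖F.diff (k + m) f ·‖ₑ) x) ^ 2

lemma measurable_geomSq (τ : ℝ≥0∞) (f : X → ℝ) : Measurable (F.geomSq τ f) :=
  .tsum fun k => (Measurable.tsum fun _ => (F.measurable_lmean k _).const_mul _).pow_const 2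

omit [Countable ι] [MeasurableSingletonClass ι] in
lemma geomSq_le (τ : ℝ≥0∞) (f : X → ℝ) (x : X) :
    F.geomSq τ f x ≤ (1 - τ)⁻¹ ^ 2 * ∑' m, τ ^ (2 * m) * ∑' k, F.shiftSq m f k x := by
  calc F.geomSq τ f x ≤ ∑' k, (1 - τ)⁻¹ ^ 2 * ∑' m, τ ^ (2 * m) * F.shiftSq m f k x := by
        refine ENNReal.tsum_le_tsum fun k => ?_
        have h := tsum_pow_two_mul_mul_rpow_le τ
          (fun m => F.lmean k (‖F.diff (k + m) f ·‖ₑ) x) two_pos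
        simp only [ENNReal.rpow_two, mul_pow, ← pow_mul, mul_comm _ 2] at h
        exact h
    _ = _ := by
        rw [ENNReal.tsum_mul_left, ENNReal.tsum_comm]
        simp only [ENNReal.tsum_mul_left]

omit [Countable ι] [MeasurableSingletonClass ι] in
lemma geomSq_rpow_le {r : ℝ} (hr : 0 < r) (τ : ℝ≥0∞) (f : X → ℝ) (x : X) :
    F.geomSq τ f x ^ r ≤ ((1 - τ)⁻¹ ^ 2) ^ r * ((1 - τ)⁻¹ ^ r *
      ∑' m, (τ ^ r) ^ m * (∑' k, F.shiftSq m f k x) ^ r) := by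
  refine (ENNReal.rpow_le_rpow (F.geomSq_le τ f x) hr.le).trans ?_
  rw [ENNReal.mul_rpow_of_nonneg _ _ hr.le]
  gcongr
  refine (tsum_pow_two_mul_mul_rpow_le τ _ hr).trans_eq ?_
  congr! 3 with m
  rw [ENNReal.mul_rpow_of_nonneg _ _ hr.le, ← ENNReal.rpow_natCast, ← ENNReal.rpow_natCast,
    ← ENNReal.rpow_mul, ← ENNReal.rpow_mul, mul_comm r]

lemma lintegral_geomSq_rpow_le {r : ℝ} (hr : 0 < r) (τ : ℝ≥0∞) {B : ℝ≥0∞}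
    (h : ∀ m, ∫⁻ x, (∑' k, F.shiftSq m f k x) ^ r ∂μ ≤ B) :
    ∫⁻ x, F.geomSq τ f x ^ r ∂μ ≤
      ((1 - τ)⁻¹ ^ 2) ^ r * ((1 - τ)⁻¹ ^ r * ((1 - τ ^ r)⁻¹ * B)) := by
  have hs := F.measurable_shiftSq
  calc _ ≤ _ := lintegral_mono (F.geomSq_rpow_le hr τ f)
    _ = ((1 - τ)⁻¹ ^ 2) ^ r * ((1 - τ)⁻¹ ^ r *
        ∑' m, ∫⁻ x, (τ ^ r) ^ m * (∑' k, F.shiftSq m f k x) ^ r ∂μ) := by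
        rw [lintegral_const_mul _ (by fun_prop), lintegral_const_mul _ (by fun_prop),
          lintegral_tsum fun m => by fun_prop]
    _ ≤ ((1 - τ)⁻¹ ^ 2) ^ r * ((1 - τ)⁻¹ ^ r * ∑' m, (τ ^ r) ^ m * B) := by
        gcongr with m
        rw [lintegral_const_mul _ (by fun_prop)]
        gcongr
        exact h m
    _ = _ := by rw [ENNReal.tsum_mul_right, ENNReal.tsum_geometric]

variable (μ ι) in
theorem exists_lintegral_geomSq_rpow_le (hD : 0 < D) (hp : 1 < p) {τ : ℝ≥0∞} (hτ : τ < 1) :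
    ∃ C : ℝ≥0, ∀ (F : CellFiltration μ ι D) (f : X → ℝ), Measurable f → Integrable f μ →
      (∀ x, 0 ≤ f x) → ∫⁻ x, ‖f x‖ₑ ^ p ∂μ < ∞ →
        ∫⁻ x, F.geomSq τ f x ^ (p / 2) ∂μ ≤ C * ∫⁻ x, ‖f x‖ₑ ^ p ∂μ := by
  obtain ⟨C, hC⟩ := exists_lintegral_sum_shiftSq_rpow_le μ ι hD hp
  have hp0 : 0 < p / 2 := by linarith
  have hgeom : (1 - τ)⁻¹ ≠ ∞ := by simpa [tsub_eq_zero_iff_le] using hτ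
  have hgeom' : (1 - τ ^ (p / 2))⁻¹ ≠ ∞ := by
    simpa [tsub_eq_zero_iff_le] using ENNReal.rpow_lt_one hτ hp0
  lift (1 - τ)⁻¹ to ℝ≥0 using hgeom with a ha
  lift (1 - τ ^ (p / 2))⁻¹ to ℝ≥0 using hgeom' with b hb
  refine ⟨(a ^ 2) ^ (p / 2) * (a ^ (p / 2) * (b * C)), fun F f hfm hf h0 hfin => ?_⟩
  refine (F.lintegral_geomSq_rpow_le hp0 τ fun m =>
    F.lintegral_tsum_shiftSq_rpow_le_of_sum hp0.le fun N =>
      hC F m N f hfm hf h0 hfin).trans_eq ?_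
  rw [← ha, ← hb]
  push_cast [ENNReal.coe_rpow_of_nonneg _ hp0.le]
  ring

end CellFiltration

/-! ### Translated dyadic grids -/

section DyadicGrid

lemma exists_int_abs_sub_le_of_floor_ne {y z δ : ℝ} (h : |z - y| ≤ δ) (hne : ⌊z⌋ ≠ ⌊y⌋) :
    ∃ a : ℤ, |y - a| ≤ δ := by
  have h' := abs_le.1 h
  rcases lt_or_gt_of_ne hne with hlt | hlt
  · have h1 := Int.floor_le y
    have h2 := Int.floor_lt.1 hlt
    exact ⟨⌊y⌋, abs_le.2 ⟨by linarith, by linarith⟩⟩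
  · have h1 := Int.floor_le z
    have h2 := Int.floor_lt.1 hlt
    exact ⟨⌊z⌋, abs_le.2 ⟨by linarith, by linarith⟩⟩

/-- A translation by `0` or by `d`. -/
def boolShift (d : ℝ) (b : Bool) : ℝ := if b then d else 0

-- The one-third trick: an interval of length less than `1 / 3` cannot meet both `ℤ` and
-- `ℤ - 2 ^ k / 3`, since 3 does not divide `2 ^ k`.
lemma exists_floor_add_boolShift_eq (k : ℕ) (y : ℝ) {δ : ℝ} (hδ : 6 * δ < 1) :
    ∃ b, ∀ z, |z - y| ≤ δ → ⌊z + boolShift (2 ^ k / 3) b⌋ = ⌊y + boolShift (2 ^ k / 3) b⌋ := by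
  by_contra! hcon
  obtain ⟨z, hz, hne⟩ := hcon false
  obtain ⟨w, hw, hne'⟩ := hcon true
  obtain ⟨a, ha⟩ := exists_int_abs_sub_le_of_floor_ne (δ := δ)
    (by rwa [add_sub_add_right_eq_sub]) hne
  obtain ⟨b, hb⟩ := exists_int_abs_sub_le_of_floor_ne (δ := δ)
    (by rwa [add_sub_add_right_eq_sub]) hne'
  simp only [boolShift, Bool.false_eq_true, if_false, if_true, abs_le] at ha hb
  have hlt : (2 : ℤ) ^ k - 3 * (b - a) < 1 := by
    have : (2 : ℝ) ^ k - 3 * (b - a) < 1 := by linarith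
    exact_mod_cast this
  have hgt : -1 < (2 : ℤ) ^ k - 3 * (b - a) := by
    have : -1 < (2 : ℝ) ^ k - 3 * (b - a) := by linarith
    exact_mod_cast this
  have hdvd : (3 : ℤ) ∣ 2 ^ k := ⟨b - a, by lia⟩
  have := Int.Prime.dvd_pow' Nat.prime_three hdvd
  lia

variable {n : ℕ}

/-- The index of the half-open cube of side `ℓ` containing `x`, in the grid of such cubes translated
by `-s`. -/
def cubeIndex (ℓ : ℝ) (s : Fin n → ℝ) (x : EuclideanSpace ℝ (Fin n)) : Fin n → ℤ :=
  fun i => ⌊(x i + s i) / ℓ⌋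

lemma measurable_cubeIndex (ℓ : ℝ) (s : Fin n → ℝ) : Measurable (cubeIndex ℓ s) :=
  measurable_pi_lambda _ fun i => Int.measurable_floor.comp (by fun_prop)

lemma cubeIndex_eq_of_half {ℓ : ℝ} {s : Fin n → ℝ} {x y : EuclideanSpace ℝ (Fin n)}
    (h : cubeIndex (ℓ / 2) s x = cubeIndex (ℓ / 2) s y) : cubeIndex ℓ s x = cubeIndex ℓ s y := by
  have hhalf : ∀ z i, cubeIndex ℓ s z i = cubeIndex (ℓ / 2) s z i / (2 : ℕ) := fun z i => by
    rw [cubeIndex, cubeIndex, ← Int.floor_div_natCast]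
    congr 1
    push_cast
    rw [div_div, div_mul_cancel₀ _ two_ne_zero]
  funext i
  rw [hhalf, hhalf, h]

lemma volume_cubeIndex_fiber {ℓ : ℝ} (hℓ : 0 < ℓ) (s : Fin n → ℝ)
    (x : EuclideanSpace ℝ (Fin n)) :
    volume {y | cubeIndex ℓ s y = cubeIndex ℓ s x} = ENNReal.ofReal ℓ ^ n := by
  have hset : {y | cubeIndex ℓ s y = cubeIndex ℓ s x} =
      (@WithLp.ofLp 2 (Fin n → ℝ)) ⁻¹' (univ.pi fun i =>
        Ico (cubeIndex ℓ s x i * ℓ - s i) ((cubeIndex ℓ s x i + 1) * ℓ - s i)) := by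
    ext y
    simp only [mem_ofPred_eq, mem_preimage, Set.mem_pi, mem_univ, true_imp_iff, funext_iff, mem_Ico]
    refine forall_congr' fun i => ?_
    conv_lhs => lhs; rw [cubeIndex]
    rw [Int.floor_eq_iff, sub_le_iff_le_add, le_div_iff₀ hℓ, lt_sub_iff_add_lt, div_lt_iff₀ hℓ]
  rw [hset, (PiLp.volume_preserving_ofLp (Fin n)).measure_preimage
    (MeasurableSet.univ_pi fun _ => measurableSet_Ico).nullMeasurableSet, Real.volume_pi_Ico]
  simp [add_mul]

lemma norm_sub_le_of_cubeIndex_eq {ℓ : ℝ} (hℓ : 0 < ℓ) {s : Fin n → ℝ}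
    {x y : EuclideanSpace ℝ (Fin n)} (h : cubeIndex ℓ s x = cubeIndex ℓ s y) :
    ‖x - y‖ ≤ √n * ℓ := by
  have hi : ∀ i, ‖(x - y) i‖ ^ 2 ≤ ℓ ^ 2 := fun i => by
    have h1 := Int.abs_sub_lt_one_of_floor_eq_floor (congrFun h i)
    rw [← sub_div, add_sub_add_right_eq_sub, abs_div, abs_of_pos hℓ, div_lt_one hℓ] at h1
    exact pow_le_pow_left₀ (norm_nonneg _) h1.le 2
  rw [EuclideanSpace.norm_eq, ← Real.sqrt_sq hℓ.le, ← Real.sqrt_mul (Nat.cast_nonneg n)]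
  exact Real.sqrt_le_sqrt ((Finset.sum_le_sum fun i _ => hi i).trans_eq (by simp))

/-- The dyadic grid translated by `-s`, whose largest cubes have side `L`. -/
def dyadicGrid {L : ℝ} (hL : 0 < L) (s : Fin n → ℝ) :
    CellFiltration (volume : Measure (EuclideanSpace ℝ (Fin n))) (Fin n → ℤ) (2 ^ n) where
  label k := cubeIndex (L / 2 ^ k) s
  measurable_label k := measurable_cubeIndex _ s
  refines k x y h := cubeIndex_eq_of_half (by rwa [div_div, ← pow_succ])
  measure_ne_zero k x := by
    rw [volume_cubeIndex_fiber (by positivity)]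
    exact pow_ne_zero _ (by simpa using by positivity)
  measure_ne_top k x := by
    rw [volume_cubeIndex_fiber (by positivity)]
    exact ENNReal.pow_ne_top ENNReal.ofReal_ne_top
  doubling k x := by
    rw [volume_cubeIndex_fiber (by positivity), volume_cubeIndex_fiber (by positivity)]
    push_cast
    rw [← mul_pow, ← ENNReal.ofReal_ofNat, ← ENNReal.ofReal_mul zero_le_two, pow_succ, ← div_div,
      mul_div_cancel₀ _ two_ne_zero]

lemma volume_cell_dyadicGrid {L : ℝ} (hL : 0 < L) (s : Fin n → ℝ) (k : ℕ)
    (x : EuclideanSpace ℝ (Fin n)) :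
    volume ((dyadicGrid hL s).cell k x) = ENNReal.ofReal (L / 2 ^ k) ^ n :=
  volume_cubeIndex_fiber (by positivity) s x

lemma exists_closedBall_subset_cell_dyadicGrid {L : ℝ} (hL : 0 < L) (k : ℕ)
    (x : EuclideanSpace ℝ (Fin n)) {t : ℝ} (ht : 6 * t < L / 2 ^ k) :
    ∃ ω : Fin n → Bool,
      Metric.closedBall x t ⊆ (dyadicGrid hL fun i => boolShift (L / 3) (ω i)).cell k x := by
  have hℓ : 0 < L / 2 ^ k := by positivity
  have hδ : 6 * (t / (L / 2 ^ k)) < 1 := by rwa [← mul_div_assoc, div_lt_one hℓ]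
  choose ω hω using fun i => exists_floor_add_boolShift_eq k (x i / (L / 2 ^ k)) hδ
  refine ⟨ω, fun z hz => funext fun i => ?_⟩
  have hzx : |z i - x i| ≤ t := (PiLp.norm_apply_le (z - x) i).trans (by rwa [← dist_eq_norm])
  have hscale : boolShift (2 ^ k / 3) (ω i) = boolShift (L / 3) (ω i) / (L / 2 ^ k) := by
    unfold boolShift
    split_ifs
    · field_simp
    · rw [zero_div]
  have hfloor := hω i (z i / (L / 2 ^ k)) (by rw [← sub_div, abs_div, abs_of_pos hℓ]; gcongr)
  rwa [hscale, ← add_div, ← add_div] at hfloor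

end DyadicGrid

/-! ### Martingale expansion of pairings -/

namespace CellFiltration

variable {X : Type*} [MeasurableSpace X] {μ : Measure X} {ι : Type*} [MeasurableSpace ι] {D : ℝ≥0}
  (F : CellFiltration μ ι D)

section Center

variable [Nonempty X]

/-- A chosen point of the cell of generation `k` containing `x`. -/
def center (k : ℕ) (x : X) : X := Function.invFun (F.label k) (F.label k x)

lemma label_center (k : ℕ) (x : X) : F.label k (F.center k x) = F.label k x :=
  Function.invFun_eq ⟨x, rfl⟩

lemma isConst_comp_center (k : ℕ) (ψ : X → ℝ) : F.IsConst k fun x => ψ (F.center k x) :=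
  fun x y h => by simp only [center, h]

end Center

variable {f : X → ℝ}

lemma enorm_mean_le (k : ℕ) (f : X → ℝ) (x : X) : ‖F.mean k f x‖ₑ ≤ F.lmean k (‖f ·‖ₑ) x := by
  rw [mean, average, lmean, laverage]
  exact enorm_integral_le_lintegral_enorm _

section SetIntegral

variable [MeasurableSingletonClass ι]

lemma setIntegral_mul_isConst (k : ℕ) (f : X → ℝ) {V : X → ℝ} (hV : F.IsConst k V) (x : X) :
    ∫ y in F.cell k x, f y * V y ∂μ = (∫ y in F.cell k x, f y ∂μ) * V x := by
  rw [← integral_mul_const]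
  exact setIntegral_congr_fun (F.measurableSet_cell k x) fun y hy => by simp only [hV y x hy]

lemma setIntegral_mean (k : ℕ) (f : X → ℝ) (x : X) :
    ∫ y in F.cell k x, F.mean k f y ∂μ = ∫ y in F.cell k x, f y ∂μ := by
  rw [setIntegral_congr_fun (g := fun _ => F.mean k f x) (F.measurableSet_cell k x)
    fun y hy => F.isConst_mean k f y x hy, setIntegral_const, mean,
    measure_smul_setAverage (s := F.cell k x) _ (F.measure_ne_top k x)]

end SetIntegral

variable [Countable ι] [MeasurableSingletonClass ι]

lemma lintegral_enorm_mean_le (k : ℕ) (hfm : Measurable f) :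
    ∫⁻ x, ‖F.mean k f x‖ₑ ∂μ ≤ ∫⁻ x, ‖f x‖ₑ ∂μ :=
  (lintegral_mono fun x => F.enorm_mean_le k f x).trans_eq (F.lintegral_lmean k hfm.enorm)

lemma integrable_mean (k : ℕ) (hfm : Measurable f) (hf : Integrable f μ) :
    Integrable (F.mean k f) μ :=
  ⟨(F.measurable_mean k f).aestronglyMeasurable, (F.lintegral_enorm_mean_le k hfm).trans_lt hf.2⟩

lemma integrable_diff (k : ℕ) (hfm : Measurable f) (hf : Integrable f μ) :
    Integrable (F.diff k f) μ :=
  (F.integrable_mean (k + 1) hfm hf).sub (F.integrable_mean k hfm hf)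

lemma hasSum_setIntegral_fibers (k : ℕ) {g : X → ℝ} (hg : Integrable g μ) :
    HasSum (fun i => ∫ x in F.label k ⁻¹' {i}, g x ∂μ) (∫ x, g x ∂μ) := by
  have hU : ⋃ i, F.label k ⁻¹' {i} = univ := by
    rw [← preimage_iUnion, iUnion_of_singleton, preimage_univ]
  have h := hasSum_integral_iUnion (μ := μ) (f := g)
    (fun i => F.measurable_label k (measurableSet_singleton i))
    (fun i j hij => Disjoint.preimage _ (by simpa using hij)) (hU ▸ hg.integrableOn)
  rwa [hU, setIntegral_univ] at h

section Pairing

variable {ψ : X → ℝ} {B : ℝ}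

lemma integral_mean_mul {k : ℕ} (hfm : Measurable f) (hf : Integrable f μ) (hψ : F.IsConst k ψ)
    (hB : ∀ x, |ψ x| ≤ B) : ∫ x, F.mean k f x * ψ x ∂μ = ∫ x, f x * ψ x ∂μ := by
  have hψm : AEStronglyMeasurable ψ μ := hψ.measurable.aestronglyMeasurable
  have hb : ∀ᵐ x ∂μ, ‖ψ x‖ ≤ B := ae_of_all _ hB
  refine (F.hasSum_setIntegral_fibers k
    ((F.integrable_mean k hfm hf).mul_bdd hψm hb)).unique ?_
  convert F.hasSum_setIntegral_fibers k (hf.mul_bdd hψm hb) using 2 with i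
  rcases (F.label k ⁻¹' {i}).eq_empty_or_nonempty with he | ⟨x, rfl⟩
  · simp [he]
  · change ∫ y in F.cell k x, _ ∂μ = ∫ y in F.cell k x, _ ∂μ
    rw [F.setIntegral_mul_isConst k _ hψ, F.setIntegral_mul_isConst k _ hψ, F.setIntegral_mean]

lemma integral_diff_mul {k : ℕ} (hfm : Measurable f) (hf : Integrable f μ) (hψ : F.IsConst k ψ)
    (hB : ∀ x, |ψ x| ≤ B) : ∫ x, F.diff k f x * ψ x ∂μ = 0 := by
  have hψm : AEStronglyMeasurable ψ μ := hψ.measurable.aestronglyMeasurable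
  have hb : ∀ᵐ x ∂μ, ‖ψ x‖ ≤ B := ae_of_all _ hB
  simp only [diff, sub_mul]
  rw [integral_sub ((F.integrable_mean (k + 1) hfm hf).mul_bdd hψm hb)
    ((F.integrable_mean k hfm hf).mul_bdd hψm hb),
    F.integral_mean_mul hfm hf (hψ.mono k.le_succ) hB, F.integral_mean_mul hfm hf hψ hB, sub_self]

lemma integral_sub_mean_mul {k : ℕ} (hfm : Measurable f) (hf : Integrable f μ)
    (hψ : F.IsConst k ψ) (hB : ∀ x, |ψ x| ≤ B) : ∫ x, (f x - F.mean k f x) * ψ x ∂μ = 0 := by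
  have hψm : AEStronglyMeasurable ψ μ := hψ.measurable.aestronglyMeasurable
  have hb : ∀ᵐ x ∂μ, ‖ψ x‖ ≤ B := ae_of_all _ hB
  simp only [sub_mul]
  rw [integral_sub (hf.mul_bdd hψm hb) ((F.integrable_mean k hfm hf).mul_bdd hψm hb),
    F.integral_mean_mul hfm hf hψ hB, sub_self]

variable (hψ : Measurable ψ) (hB : ∀ y, |ψ y| ≤ B) {k : ℕ} {x : X}
  (hsupp : ∀ y ∉ F.cell k x, ψ y = 0)

include hψ hB hsupp

lemma integral_mul_eq_sub_mean_add_sum_diff (hint : ∫ y, ψ y ∂μ = 0) (hfm : Measurable f)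
    (hf : Integrable f μ) (M : ℕ) :
    ∫ y, f y * ψ y ∂μ = ∫ y, (f y - F.mean (k + M) f y) * ψ y ∂μ +
      ∑ m ∈ Finset.range M, ∫ y, F.diff (k + m) f y * ψ y ∂μ := by
  have hψm : AEStronglyMeasurable ψ μ := hψ.aestronglyMeasurable
  have hb : ∀ᵐ x ∂μ, ‖ψ x‖ ≤ B := ae_of_all _ hB
  have hmean := fun j => (F.integrable_mean j hfm hf).mul_bdd hψm hb
  simp only [diff, sub_mul]
  rw [integral_sub (hf.mul_bdd hψm hb) (hmean _)]
  have htop : ∫ y, F.mean k f y * ψ y ∂μ = 0 := by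
    have : ∀ y, F.mean k f y * ψ y = F.mean k f x * ψ y := fun y => by
      by_cases hy : y ∈ F.cell k x
      · rw [F.isConst_mean k f y x hy]
      · rw [hsupp y hy, mul_zero, mul_zero]
    simp only [this, integral_const_mul, hint, mul_zero]
  have htele : ∀ m, ∫ y, F.mean (k + m + 1) f y * ψ y - F.mean (k + m) f y * ψ y ∂μ =
      ∫ y, F.mean (k + (m + 1)) f y * ψ y ∂μ - ∫ y, F.mean (k + m) f y * ψ y ∂μ :=
    fun m => integral_sub (hmean _) (hmean _)
  simp only [htele]
  rw [Finset.sum_range_sub fun m => ∫ y, F.mean (k + m) f y * ψ y ∂μ, add_zero, htop]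
  ring

variable [Nonempty X]

lemma enorm_integral_mul_le_of_integral_center {j : ℕ} (hkj : k ≤ j) {ε : ℝ≥0}
    (hε : ∀ y z, F.label j y = F.label j z → |ψ y - ψ z| ≤ ε) {g : X → ℝ} (hg : Integrable g μ)
    (horth : ∫ y, g y * ψ (F.center j y) ∂μ = 0) :
    ‖∫ y, g y * ψ y ∂μ‖ₑ ≤ ε * ∫⁻ y in F.cell k x, ‖g y‖ₑ ∂μ := by
  have hosc : ∀ y, ‖ψ y - ψ (F.center j y)‖ₑ ≤ ε := fun y => by
    rw [Real.enorm_eq_ofReal_abs, ← ENNReal.ofReal_coe_nnreal]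
    exact ENNReal.ofReal_le_ofReal (hε _ _ (F.label_center j y).symm)
  have hsub : ∫ y, g y * ψ y ∂μ = ∫ y, g y * (ψ y - ψ (F.center j y)) ∂μ := by
    simp only [mul_sub]
    rw [integral_sub (hg.mul_bdd hψ.aestronglyMeasurable (ae_of_all _ hB))
      (hg.mul_bdd (F.isConst_comp_center j ψ).measurable.aestronglyMeasurable
        (ae_of_all _ fun _ => hB _)), horth, sub_zero]
  rw [hsub, ← lintegral_const_mul' _ _ ENNReal.coe_ne_top,
    ← lintegral_indicator (F.measurableSet_cell k x)]
  refine (enorm_integral_le_lintegral_enorm _).trans (lintegral_mono fun y => ?_)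
  by_cases hy : y ∈ F.cell k x
  · rw [indicator_of_mem hy, enorm_mul, mul_comm]
    gcongr
    exact hosc y
  · have hy' : F.center j y ∉ F.cell k x := fun h => hy
      ((F.label_of_le hkj (F.label_center j y)).symm.trans h)
    simp [hsupp y hy, hsupp _ hy']

lemma enorm_integral_diff_mul_le {j : ℕ} (hkj : k ≤ j) {ε : ℝ≥0}
    (hε : ∀ y z, F.label j y = F.label j z → |ψ y - ψ z| ≤ ε) (hfm : Measurable f)
    (hf : Integrable f μ) :
    ‖∫ y, F.diff j f y * ψ y ∂μ‖ₑ ≤ μ (F.cell k x) * (ε * F.lmean k (‖F.diff j f ·‖ₑ) x) := by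
  refine (F.enorm_integral_mul_le_of_integral_center hψ hB hsupp hkj hε
    (F.integrable_diff j hfm hf)
    (F.integral_diff_mul hfm hf (F.isConst_comp_center j ψ) fun _ => hB _)).trans_eq ?_
  rw [← F.measure_mul_lmean, mul_left_comm]

lemma enorm_integral_sub_mean_mul_le {j : ℕ} (hkj : k ≤ j) {ε : ℝ≥0}
    (hε : ∀ y z, F.label j y = F.label j z → |ψ y - ψ z| ≤ ε) (hfm : Measurable f)
    (hf : Integrable f μ) :
    ‖∫ y, (f y - F.mean j f y) * ψ y ∂μ‖ₑ ≤ ε * (2 * ∫⁻ y, ‖f y‖ₑ ∂μ) := by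
  refine (F.enorm_integral_mul_le_of_integral_center hψ hB hsupp hkj hε
    (hf.sub (F.integrable_mean j hfm hf))
    (F.integral_sub_mean_mul hfm hf (F.isConst_comp_center j ψ) fun _ => hB _)).trans ?_
  gcongr
  calc ∫⁻ y in F.cell k x, ‖f y - F.mean j f y‖ₑ ∂μ
      ≤ ∫⁻ y, ‖f y‖ₑ + ‖F.mean j f y‖ₑ ∂μ :=
        (setLIntegral_le_lintegral _ _).trans (lintegral_mono fun _ => enorm_sub_le)
    _ ≤ 2 * ∫⁻ y, ‖f y‖ₑ ∂μ := by
        rw [lintegral_add_left hfm.enorm, two_mul]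
        exact add_le_add_right (F.lintegral_enorm_mean_le j hfm) _

-- `ψ` is paired with the martingale expansion of `f`; its cancellation kills the generation `k`
-- mean, and the orthogonality of the differences gains its oscillation `ε` on the finer cells.
lemma enorm_integral_mul_le_tsum_diff (hint : ∫ y, ψ y ∂μ = 0) {ε : ℕ → ℝ≥0}
    (hε : ∀ j y z, F.label j y = F.label j z → |ψ y - ψ z| ≤ ε j) (hlim : Tendsto ε atTop (𝓝 0))
    (hfm : Measurable f) (hf : Integrable f μ) :
    ‖∫ y, f y * ψ y ∂μ‖ₑ ≤
      μ (F.cell k x) * ∑' m, ε (k + m) * F.lmean k (‖F.diff (k + m) f ·‖ₑ) x := by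
  set S := μ (F.cell k x) * ∑' m, ε (k + m) * F.lmean k (‖F.diff (k + m) f ·‖ₑ) x with hS
  have hbound : ∀ M, ‖∫ y, f y * ψ y ∂μ‖ₑ ≤ ε (k + M) * (2 * ∫⁻ y, ‖f y‖ₑ ∂μ) + S := fun M => by
    rw [F.integral_mul_eq_sub_mean_add_sum_diff hψ hB hsupp hint hfm hf M]
    refine (enorm_add_le _ _).trans (add_le_add (F.enorm_integral_sub_mean_mul_le hψ hB hsupp
      (Nat.le_add_right k M) (hε _) hfm hf) ?_)
    rw [hS, ← ENNReal.tsum_mul_left]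
    exact (enorm_sum_le _ _).trans ((Finset.sum_le_sum fun m _ =>
      F.enorm_integral_diff_mul_le hψ hB hsupp (Nat.le_add_right k m) (hε _) hfm hf).trans
        (ENNReal.sum_le_tsum _))
  have hfin : 2 * ∫⁻ y, ‖f y‖ₑ ∂μ ≠ ∞ := ENNReal.mul_ne_top (by simp) hf.2.ne
  have hε0 : Tendsto (fun M => (ε (k + M) : ℝ≥0∞)) atTop (𝓝 0) :=
    ENNReal.tendsto_coe.2 (hlim.comp (tendsto_atTop_mono (fun M => Nat.le_add_left M k) tendsto_id))
  have hl := (ENNReal.Tendsto.mul_const hε0 (Or.inr hfin)).add_const S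
  rw [zero_mul, zero_add] at hl
  exact ge_of_tendsto' hl hbound

end Pairing

end CellFiltration

/-! ### Intrinsic square functions -/

section Admissible

variable {n : ℕ} {α : ℝ} {φ : EuclideanSpace ℝ (Fin n) → ℝ}

namespace IsAdmissible

lemma continuous (hφ : IsAdmissible α φ) (hα : 0 < α) : Continuous φ := by
  refine continuous_iff_continuousAt.2 fun x => tendsto_iff_norm_sub_tendsto_zero.2 ?_
  refine squeeze_zero (fun _ => norm_nonneg _) (fun y => hφ.holder y x) ?_
  have : Continuous fun y => ‖y - x‖ ^ α :=
    (continuous_id.sub continuous_const).norm.rpow_const fun _ => Or.inr hα.le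
  simpa [Real.zero_rpow hα.ne'] using this.tendsto x

lemma eq_zero_of_one_le_norm (hφ : IsAdmissible α φ) (hα : 0 < α) {x : EuclideanSpace ℝ (Fin n)}
    (hx : 1 ≤ ‖x‖) : φ x = 0 := by
  have hsupp : Function.support φ ⊆ Metric.ball 0 1 := by
    rw [← interior_closedBall _ one_ne_zero]
    exact interior_maximal hφ.support_subset (hφ.continuous hα).isOpen_support
  by_contra hne
  exact hx.not_gt (by simpa using hsupp hne)

lemma abs_le_one [NeZero n] (hφ : IsAdmissible α φ) (hα : 0 < α) (x : EuclideanSpace ℝ (Fin n)) :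
    |φ x| ≤ 1 := by
  rcases le_total 1 ‖x‖ with hx1 | hx1
  · rw [hφ.eq_zero_of_one_le_norm hα hx1, abs_zero]
    exact zero_le_one
  obtain ⟨y, hy, hxy⟩ : ∃ y : EuclideanSpace ℝ (Fin n), ‖y‖ = 1 ∧ ‖x - y‖ ≤ 1 := by
    rcases eq_or_ne x 0 with rfl | hx
    · obtain ⟨y, hy⟩ := _root_.exists_norm_eq (EuclideanSpace ℝ (Fin n)) zero_le_one
      exact ⟨y, hy, by rw [zero_sub, norm_neg, hy]⟩
    · have hx0 : 0 < ‖x‖ := norm_pos_iff.2 hx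
      refine ⟨‖x‖⁻¹ • x, by rw [norm_smul, norm_inv, norm_norm, inv_mul_cancel₀ hx0.ne'], ?_⟩
      calc ‖x - ‖x‖⁻¹ • x‖ = |1 - ‖x‖⁻¹| * ‖x‖ := by
            rw [← Real.norm_eq_abs, ← norm_smul, sub_smul, one_smul]
        _ = 1 - ‖x‖ := by
            rw [abs_of_nonpos (sub_nonpos.2 ((one_le_inv₀ hx0).2 hx1)), neg_sub, sub_mul,
              inv_mul_cancel₀ hx0.ne', one_mul]
        _ ≤ 1 := sub_le_self _ hx0.le
  calc |φ x| = |φ x - φ y| := by rw [hφ.eq_zero_of_one_le_norm hα hy.ge, sub_zero]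
    _ ≤ ‖x - y‖ ^ α := hφ.holder x y
    _ ≤ 1 := Real.rpow_le_one (norm_nonneg _) hxy hα.le

end IsAdmissible

lemma dilate_sub_eq_zero (hφ : IsAdmissible α φ) (hα : 0 < α) {t : ℝ} (ht : 0 < t)
    {x z : EuclideanSpace ℝ (Fin n)} (hz : z ∉ Metric.closedBall x t) : dilate φ t (x - z) = 0 := by
  rw [Metric.mem_closedBall, dist_comm, dist_eq_norm, not_le] at hz
  rw [dilate, hφ.eq_zero_of_one_le_norm hα, mul_zero]
  rw [norm_smul, norm_inv, Real.norm_of_nonneg ht.le, inv_mul_eq_div, one_le_div ht]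
  exact hz.le

lemma abs_dilate_le [NeZero n] (hφ : IsAdmissible α φ) (hα : 0 < α) {t : ℝ} (ht : 0 < t)
    (x : EuclideanSpace ℝ (Fin n)) : |dilate φ t x| ≤ (t ^ n)⁻¹ := by
  rw [dilate, abs_mul, abs_of_pos (by positivity)]
  exact mul_le_of_le_one_right (by positivity) (hφ.abs_le_one hα _)

lemma abs_dilate_sub_dilate_le (hφ : IsAdmissible α φ) (hα : 0 < α) {t : ℝ} (ht : 0 < t)
    {x y : EuclideanSpace ℝ (Fin n)} {d : ℝ} (hd : ‖x - y‖ ≤ d) :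
    |dilate φ t x - dilate φ t y| ≤ (t ^ n)⁻¹ * (d / t) ^ α := by
  rw [dilate, dilate, ← mul_sub, abs_mul, abs_of_pos (by positivity)]
  gcongr
  refine (hφ.holder _ _).trans (Real.rpow_le_rpow (norm_nonneg _) ?_ hα.le)
  rw [← smul_sub, norm_smul, norm_inv, Real.norm_of_nonneg ht.le, inv_mul_eq_div]
  gcongr

lemma integral_dilate_sub (hφ : IsAdmissible α φ) (t : ℝ) (x : EuclideanSpace ℝ (Fin n)) :
    ∫ z, dilate φ t (x - z) = 0 := by
  rw [integral_sub_left_eq_self (fun z => dilate φ t z) volume x]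
  simp only [dilate]
  rw [integral_const_mul, Measure.integral_comp_smul, hφ.integral_eq_zero, smul_zero, mul_zero]

lemma continuousAt_dilate (hφ : IsAdmissible α φ) (hα : 0 < α) {t : ℝ} (ht : t ≠ 0)
    (x : EuclideanSpace ℝ (Fin n)) :
    ContinuousAt (fun q : EuclideanSpace ℝ (Fin n) × ℝ => dilate φ q.2 q.1) (x, t) := by
  refine ContinuousAt.mul ?_ ((hφ.continuous hα).continuousAt.comp ?_)
  · exact (continuous_snd.continuousAt.pow n).inv₀ (pow_ne_zero n ht)
  · exact (continuous_snd.continuousAt.inv₀ ht).smul continuous_fst.continuousAt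

lemma continuous_dilate_sub (hφ : IsAdmissible α φ) (hα : 0 < α) (t : ℝ)
    (x : EuclideanSpace ℝ (Fin n)) : Continuous fun z => dilate φ t (x - z) := by
  have := hφ.continuous hα
  unfold dilate
  fun_prop

end Admissible

section SupConv

variable {n : ℕ} {α : ℝ} {φ : EuclideanSpace ℝ (Fin n) → ℝ} {𝕜 : Type*} [RCLike 𝕜]
  {f g : EuclideanSpace ℝ (Fin n) → 𝕜}

lemma enorm_integral_dilate_le_supConv (hφ : IsAdmissible α φ)
    (f : EuclideanSpace ℝ (Fin n) → 𝕜) (x : EuclideanSpace ℝ (Fin n)) (t : ℝ) :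
    ‖∫ z, dilate φ t (x - z) • f z‖ₑ ≤ supConv α f x t :=
  le_iSup₂ (f := fun φ (_ : IsAdmissible α φ) => ‖∫ z, dilate φ t (x - z) • f z‖ₑ) φ hφ

lemma supConv_congr_ae (hfg : f =ᵐ[volume] g) : supConv α f = supConv α g := by
  funext x t
  refine iSup_congr fun φ => iSup_congr fun _ => congrArg _ (integral_congr_ae ?_)
  filter_upwards [hfg] with z hz
  rw [hz]

lemma integrable_dilate_sub_smul (hφ : IsAdmissible α φ) (hα : 0 < α) {t : ℝ} (ht : 0 < t)
    (x : EuclideanSpace ℝ (Fin n)) (hf : LocallyIntegrable f) :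
    Integrable fun z => dilate φ t (x - z) • f z :=
  hf.integrable_smul_left_of_hasCompactSupport (continuous_dilate_sub hφ hα t x)
    (.intro (isCompact_closedBall x t) fun _ => dilate_sub_eq_zero hφ hα ht)

lemma supConv_add_le (hα : 0 < α) {t : ℝ} (ht : 0 < t) (x : EuclideanSpace ℝ (Fin n))
    (hf : LocallyIntegrable f) (hg : LocallyIntegrable g) :
    supConv α (f + g) x t ≤ supConv α f x t + supConv α g x t := by
  refine iSup₂_le fun φ hφ => ?_
  simp only [Pi.add_apply, smul_add]
  rw [integral_add (integrable_dilate_sub_smul hφ hα ht x hf)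
    (integrable_dilate_sub_smul hφ hα ht x hg)]
  exact (enorm_add_le _ _).trans (add_le_add (enorm_integral_dilate_le_supConv hφ f x t)
    (enorm_integral_dilate_le_supConv hφ g x t))

lemma norm_dilate_sub_smul_le [NeZero n] (hφ : IsAdmissible α φ) (hα : 0 < α) {s t R : ℝ}
    (hs : 0 < s) {x y z : EuclideanSpace ℝ (Fin n)} (hst : s ≤ t)
    (hR : Metric.closedBall y t ⊆ Metric.closedBall x R) (f : EuclideanSpace ℝ (Fin n) → 𝕜) :
    ‖dilate φ t (y - z) • f z‖ ≤
      (Metric.closedBall x R).indicator (fun z => (s ^ n)⁻¹ * ‖f z‖) z := by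
  have ht := hs.trans_le hst
  by_cases hz : z ∈ Metric.closedBall x R
  · rw [indicator_of_mem hz, norm_smul]
    gcongr
    exact (abs_dilate_le hφ hα ht _).trans (by gcongr)
  · rw [dilate_sub_eq_zero hφ hα ht fun h => hz (hR h), zero_smul, norm_zero,
      indicator_of_notMem hz]

lemma supConv_le_setLAverage [NeZero n] (hα : 0 < α) {t : ℝ} (ht : 0 < t)
    (f : EuclideanSpace ℝ (Fin n) → 𝕜) (x : EuclideanSpace ℝ (Fin n)) :
    supConv α f x t ≤ volume (Metric.ball (0 : EuclideanSpace ℝ (Fin n)) 1) *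
      ⨍⁻ z in Metric.closedBall x t, ‖f z‖ₑ ∂volume := by
  have hball : volume (Metric.ball (0 : EuclideanSpace ℝ (Fin n)) 1) ≠ 0 :=
    (Metric.measure_ball_pos _ _ one_pos).ne'
  have hbound : ∀ φ, IsAdmissible α φ → ‖∫ z, dilate φ t (x - z) • f z‖ₑ ≤
      ENNReal.ofReal (t ^ n)⁻¹ * ∫⁻ z in Metric.closedBall x t, ‖f z‖ₑ := fun φ hφ => by
    rw [← lintegral_const_mul' _ _ ENNReal.ofReal_ne_top,
      ← lintegral_indicator Metric.isClosed_closedBall.measurableSet]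
    refine (enorm_integral_le_lintegral_enorm _).trans (lintegral_mono fun z => ?_)
    by_cases hz : z ∈ Metric.closedBall x t
    · rw [indicator_of_mem hz, enorm_smul, Real.enorm_eq_ofReal_abs]
      gcongr
      exact abs_dilate_le hφ hα ht _
    · rw [dilate_sub_eq_zero hφ hα ht hz, zero_smul, enorm_zero]
      exact zero_le
  refine (iSup₂_le hbound).trans_eq ?_
  rw [setLAverage_eq, Measure.addHaar_closedBall _ _ ht.le, finrank_euclideanSpace_fin,
    ENNReal.ofReal_inv_of_pos (by positivity), ENNReal.div_eq_inv_mul, ← mul_assoc,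
    ENNReal.mul_inv (Or.inr measure_ball_lt_top.ne) (Or.inl ENNReal.ofReal_ne_top),
    mul_left_comm, ENNReal.mul_inv_cancel hball measure_ball_lt_top.ne, mul_one]

lemma continuousOn_integral_dilate [NeZero n] (hφ : IsAdmissible α φ) (hα : 0 < α)
    (hf : LocallyIntegrable f) :
    ContinuousOn (fun q : EuclideanSpace ℝ (Fin n) × ℝ => ∫ z, dilate φ q.2 (q.1 - z) • f z)
      {q | 0 < q.2} := by
  rintro ⟨x, t⟩ (ht : 0 < t)
  refine ContinuousAt.continuousWithinAt ?_
  have hnear : ∀ᶠ q : EuclideanSpace ℝ (Fin n) × ℝ in 𝓝 (x, t),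
      t / 2 ≤ q.2 ∧ Metric.closedBall q.1 q.2 ⊆ Metric.closedBall x (2 * t + 1) := by
    filter_upwards [(continuous_fst.tendsto (x, t)).eventually (Metric.ball_mem_nhds x one_pos),
      (continuous_snd.tendsto (x, t)).eventually (Icc_mem_nhds (half_lt_self ht)
        (lt_mul_of_one_lt_left ht one_lt_two))] with q hx hq
    refine ⟨hq.1, Metric.closedBall_subset_closedBall' ?_⟩
    linarith [hq.2, Metric.mem_ball.1 hx]
  refine continuousAt_of_dominated (bound := (Metric.closedBall x (2 * t + 1)).indicator
    fun z => ((t / 2) ^ n)⁻¹ * ‖f z‖) ?_ ?_ ?_ ?_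
  · exact .of_forall fun q => (continuous_dilate_sub hφ hα q.2 q.1).aestronglyMeasurable.smul
      hf.aestronglyMeasurable
  · filter_upwards [hnear] with q hq
    exact ae_of_all _ fun z => norm_dilate_sub_smul_le hφ hα (half_pos ht) hq.1 hq.2 f
  · rw [integrable_indicator_iff Metric.isClosed_closedBall.measurableSet]
    exact ((hf.integrableOn_isCompact (isCompact_closedBall x _)).norm).const_mul _
  · refine ae_of_all _ fun z => ContinuousAt.smul ?_ continuousAt_const
    exact ContinuousAt.comp (x := (x, t))
      (f := fun q : EuclideanSpace ℝ (Fin n) × ℝ => (q.1 - z, q.2))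
      (g := fun q : EuclideanSpace ℝ (Fin n) × ℝ => dilate φ q.2 q.1)
      (continuousAt_dilate hφ hα ht.ne' (x - z)) (by fun_prop)

lemma measurable_indicator_supConv [NeZero n] (hα : 0 < α) (hf : LocallyIntegrable f) :
    Measurable ({q : EuclideanSpace ℝ (Fin n) × ℝ | 0 < q.2}.indicator
      fun q => supConv α f q.1 q.2) := by
  have hopen : IsOpen {q : EuclideanSpace ℝ (Fin n) × ℝ | 0 < q.2} :=
    isOpen_lt continuous_const continuous_snd
  refine measurable_of_Ioi fun c => IsOpen.measurableSet ?_
  have hset : {q : EuclideanSpace ℝ (Fin n) × ℝ | 0 < q.2}.indicator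
      (fun q => supConv α f q.1 q.2) ⁻¹' Ioi c =
        ⋃ φ : {φ : EuclideanSpace ℝ (Fin n) → ℝ // IsAdmissible α φ},
          {q : EuclideanSpace ℝ (Fin n) × ℝ | 0 < q.2} ∩
            (fun q => ‖∫ z, dilate φ.1 q.2 (q.1 - z) • f z‖ₑ) ⁻¹' Ioi c := by
    ext q
    by_cases hq : 0 < q.2 <;> simp [indicator, supConv, lt_iSup_iff, hq]
  rw [hset]
  exact isOpen_iUnion fun φ =>
    (continuousOn_integral_dilate φ.2 hα hf).enorm.isOpen_inter_preimage hopen isOpen_Ioi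

lemma aemeasurable_supConv [NeZero n] (hα : 0 < α) (hf : LocallyIntegrable f)
    (x : EuclideanSpace ℝ (Fin n)) :
    AEMeasurable (supConv α f x) (volume.restrict (Ioi 0)) := by
  refine ((measurable_indicator_supConv hα hf).comp
    (measurable_prodMk_left (x := x))).aemeasurable.congr ?_
  filter_upwards [ae_restrict_mem measurableSet_Ioi] with t ht
  exact indicator_of_mem (s := {q : EuclideanSpace ℝ (Fin n) × ℝ | 0 < q.2}) (a := (x, t)) ht _

lemma measurable_setLIntegral_supConv [NeZero n] (hα : 0 < α) (hf : LocallyIntegrable f)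
    {T : Set ℝ} (hT : MeasurableSet T) (hpos : T ⊆ Ioi 0) :
    Measurable fun x => ∫⁻ t in T, supConv α f x t ^ (2 : ℕ) / ENNReal.ofReal t := by
  have hm := measurable_indicator_supConv hα hf
  have hm2 : Measurable fun q : EuclideanSpace ℝ (Fin n) × ℝ =>
      {q : EuclideanSpace ℝ (Fin n) × ℝ | 0 < q.2}.indicator
        (fun q => supConv α f q.1 q.2) q ^ 2 / ENNReal.ofReal q.2 := by
    fun_prop
  convert hm2.lintegral_prod_right' (ν := volume.restrict T) using 2 with x
  refine setLIntegral_congr_fun hT fun t ht => ?_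
  simp only
  rw [indicator_of_mem (show (x, t) ∈ {q : EuclideanSpace ℝ (Fin n) × ℝ | 0 < q.2} from hpos ht)]

lemma measurable_gFun [NeZero n] (hα : 0 < α) (hf : LocallyIntegrable f) :
    Measurable (gFun α f) :=
  (measurable_setLIntegral_supConv hα hf measurableSet_Ioi le_rfl).pow_const _

lemma gFun_eq_lintegral_rpow_two (α : ℝ) (f : EuclideanSpace ℝ (Fin n) → 𝕜)
    (x : EuclideanSpace ℝ (Fin n)) : gFun α f x =
      (∫⁻ t in Ioi 0, (supConv α f x t / ENNReal.ofReal √t) ^ (2 : ℝ)) ^ (1 / 2 : ℝ) := by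
  rw [gFun]
  congr 1
  refine setLIntegral_congr_fun measurableSet_Ioi fun t ht => ?_
  rw [ENNReal.div_rpow_of_nonneg _ _ zero_le_two, ENNReal.rpow_two, ENNReal.rpow_two,
    ← ENNReal.ofReal_pow (Real.sqrt_nonneg t), Real.sq_sqrt (le_of_lt ht)]

lemma gFun_le_add_of_supConv_le [NeZero n] {𝕜' : Type*} [RCLike 𝕜'] (hα : 0 < α)
    {h : EuclideanSpace ℝ (Fin n) → 𝕜'} (hf : LocallyIntegrable f) (hg : LocallyIntegrable g)
    {x : EuclideanSpace ℝ (Fin n)}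
    (hle : ∀ t, 0 < t → supConv α h x t ≤ supConv α f x t + supConv α g x t) :
    gFun α h x ≤ gFun α f x + gFun α g x := by
  simp only [gFun_eq_lintegral_rpow_two]
  refine le_trans ?_ (ENNReal.lintegral_Lp_add_le (p := 2)
    ((aemeasurable_supConv hα hf x).div (by fun_prop))
    ((aemeasurable_supConv hα hg x).div (by fun_prop)) one_le_two)
  refine ENNReal.rpow_le_rpow (setLIntegral_mono' measurableSet_Ioi fun t ht => ?_) (by norm_num)
  rw [Pi.add_apply, ← ENNReal.add_div]
  gcongr
  exact hle t ht

lemma gFun_add_le [NeZero n] (hα : 0 < α) (hf : LocallyIntegrable f) (hg : LocallyIntegrable g)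
    (x : EuclideanSpace ℝ (Fin n)) : gFun α (f + g) x ≤ gFun α f x + gFun α g x :=
  gFun_le_add_of_supConv_le hα hf hg fun _ ht => supConv_add_le hα ht x hf hg

end SupConv

section GridDomination

variable {n : ℕ} {α : ℝ}

/-- A bound for the oscillation of the dilate `φ_t` of an admissible function over a cube of side
`ℓ`. -/
def oscBound (n : ℕ) (α t ℓ : ℝ) : ℝ≥0 := ((t ^ n)⁻¹ * (√n * ℓ / t) ^ α).toNNReal

/-- The square root of the factor `2 ^ (-α)` that `oscBound` gains when the cube is halved. It is
the ratio of the square function `CellFiltration.geomSq` that dominates `supConv`. -/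
def decay (α : ℝ) : ℝ≥0∞ := ENNReal.ofReal (2 ^ (-(α / 2)))

/-- The constant in the domination of `supConv` by dyadic martingale differences; `14` bounds the
ratio of the side of the cube to the scale `t`. -/
def gridConst (n : ℕ) (α : ℝ) : ℝ≥0∞ := ENNReal.ofReal (14 ^ n * (√n * 14) ^ α)

lemma decay_lt_one (hα : 0 < α) : decay α < 1 := by
  rw [decay, ENNReal.ofReal_lt_one]
  exact Real.rpow_lt_one_of_one_lt_of_neg one_lt_two (by linarith)

lemma tendsto_oscBound (hα : 0 < α) (t L : ℝ) :
    Tendsto (fun j : ℕ => oscBound n α t (L / 2 ^ j)) atTop (𝓝 0) := by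
  have hside : Tendsto (fun j : ℕ => L / 2 ^ j) atTop (𝓝 0) :=
    tendsto_const_nhds.div_atTop (tendsto_pow_atTop_atTop_of_one_lt one_lt_two)
  have hreal : Tendsto (fun j : ℕ => (t ^ n)⁻¹ * (√n * (L / 2 ^ j) / t) ^ α) atTop (𝓝 0) := by
    simpa [Real.zero_rpow hα.ne'] using
      (((hside.const_mul √n).div_const t).rpow_const (Or.inr hα.le)).const_mul (t ^ n)⁻¹
  rw [← Real.toNNReal_zero]
  exact (continuous_real_toNNReal.tendsto 0).comp hreal

lemma ofReal_pow_mul_oscBound_le (hα : 0 ≤ α) {t ℓ : ℝ} (ht : 0 < t) (hℓ : 0 < ℓ)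
    (hℓt : ℓ ≤ 14 * t) (m : ℕ) :
    ENNReal.ofReal ℓ ^ n * oscBound n α t (ℓ / 2 ^ m) ≤ gridConst n α * decay α ^ (2 * m) := by
  have hratio : ℓ / t ≤ 14 := (div_le_iff₀ ht).2 hℓt
  have hdecay : ((2 ^ m)⁻¹ : ℝ) ^ α = ((2 : ℝ) ^ (-(α / 2))) ^ (2 * m) := by
    rw [← Real.rpow_natCast 2 m, ← Real.rpow_neg zero_le_two, ← Real.rpow_mul zero_le_two,
      ← Real.rpow_natCast _ (2 * m), ← Real.rpow_mul zero_le_two]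
    congr 1
    push_cast
    ring
  have hreal : ℓ ^ n * ((t ^ n)⁻¹ * (√n * (ℓ / 2 ^ m) / t) ^ α) ≤
      14 ^ n * (√n * 14) ^ α * ((2 : ℝ) ^ (-(α / 2))) ^ (2 * m) := by
    calc ℓ ^ n * ((t ^ n)⁻¹ * (√n * (ℓ / 2 ^ m) / t) ^ α)
        = (ℓ / t) ^ n * (√n * (ℓ / t) * (2 ^ m)⁻¹) ^ α := by
          rw [div_pow, div_eq_mul_inv (ℓ ^ n), mul_assoc]
          congr 3
          ring
      _ = (ℓ / t) ^ n * (√n * (ℓ / t)) ^ α * ((2 : ℝ) ^ (-(α / 2))) ^ (2 * m) := by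
          rw [Real.mul_rpow (by positivity) (by positivity), hdecay, mul_assoc]
      _ ≤ _ := by gcongr
  rw [gridConst, decay, oscBound, ← ENNReal.ofReal, ← ENNReal.ofReal_pow hℓ.le,
    ← ENNReal.ofReal_pow (by positivity), ← ENNReal.ofReal_mul (by positivity),
    ← ENNReal.ofReal_mul (by positivity)]
  exact ENNReal.ofReal_le_ofReal hreal

variable [NeZero n] {f : EuclideanSpace ℝ (Fin n) → ℝ} {L t : ℝ} {k : ℕ}
  {x : EuclideanSpace ℝ (Fin n)}

lemma supConv_le_of_closedBall_subset_cell (hα : 0 < α) (hL : 0 < L) (hfm : Measurable f)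
    (hf : Integrable f) (ht : 0 < t) (hLt : L / 2 ^ k ≤ 14 * t) {s : Fin n → ℝ}
    (hsub : Metric.closedBall x t ⊆ (dyadicGrid hL s).cell k x) :
    supConv α f x t ≤ gridConst n α * ∑' m, decay α ^ (2 * m) *
      (dyadicGrid hL s).lmean k (‖(dyadicGrid hL s).diff (k + m) f ·‖ₑ) x := by
  set F := dyadicGrid hL s with hF
  refine iSup₂_le fun φ hφ => ?_
  have hosc : ∀ j y z, F.label j y = F.label j z →
      |dilate φ t (x - y) - dilate φ t (x - z)| ≤ oscBound n α t (L / 2 ^ j) := fun j y z hyz => by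
    refine (abs_dilate_sub_dilate_le hφ hα ht ?_).trans (Real.le_coe_toNNReal _)
    rw [sub_sub_sub_cancel_left, norm_sub_rev]
    exact norm_sub_le_of_cubeIndex_eq (by positivity) hyz
  calc ‖∫ z, dilate φ t (x - z) • f z‖ₑ = ‖∫ z, f z * dilate φ t (x - z)‖ₑ := by
        simp only [smul_eq_mul, mul_comm]
    _ ≤ volume (F.cell k x) * ∑' m, oscBound n α t (L / 2 ^ (k + m)) *
          F.lmean k (‖F.diff (k + m) f ·‖ₑ) x :=
        F.enorm_integral_mul_le_tsum_diff (continuous_dilate_sub hφ hα t x).measurable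
          (fun y => abs_dilate_le hφ hα ht (x - y))
          (fun y hy => dilate_sub_eq_zero hφ hα ht fun h => hy (hsub h))
          (integral_dilate_sub hφ t x) hosc (tendsto_oscBound hα t L) hfm hf
    _ ≤ gridConst n α * ∑' m, decay α ^ (2 * m) * F.lmean k (‖F.diff (k + m) f ·‖ₑ) x := by
        rw [← ENNReal.tsum_mul_left, ← ENNReal.tsum_mul_left]
        refine ENNReal.tsum_le_tsum fun m => ?_
        rw [← mul_assoc, ← mul_assoc, hF, volume_cell_dyadicGrid, pow_add, ← div_div]
        exact mul_le_mul' (ofReal_pow_mul_oscBound_le hα.le ht (by positivity) hLt m) le_rfl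

lemma supConv_sq_le_sum_dyadicGrid (hα : 0 < α) (hL : 0 < L) (hfm : Measurable f)
    (hf : Integrable f) (ht : 0 < t) (hLt : L / 2 ^ k ≤ 14 * t) (htL : 6 * t < L / 2 ^ k) :
    supConv α f x t ^ 2 ≤ gridConst n α ^ 2 * ∑ ω : Fin n → Bool,
      let F := dyadicGrid hL fun i => boolShift (L / 3) (ω i)
      (∑' m, decay α ^ (2 * m) * F.lmean k (‖F.diff (k + m) f ·‖ₑ) x) ^ 2 := by
  obtain ⟨ω, hω⟩ := exists_closedBall_subset_cell_dyadicGrid hL k x htL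
  refine (pow_le_pow_left₀ zero_le
    (supConv_le_of_closedBall_subset_cell hα hL hfm hf ht hLt hω) 2).trans ?_
  rw [mul_pow]
  gcongr
  exact Finset.single_le_sum (f := fun ω : Fin n → Bool =>
    let F := dyadicGrid hL fun i => boolShift (L / 3) (ω i)
    (∑' m, decay α ^ (2 * m) * F.lmean k (‖F.diff (k + m) f ·‖ₑ) x) ^ 2)
    (fun _ _ => zero_le) (Finset.mem_univ ω)

lemma lintegral_Ico_div_le {a : ℝ} (ha : 0 < a) (c : ℝ≥0∞) :
    ∫⁻ t in Ico a (2 * a), c / ENNReal.ofReal t ≤ c := by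
  calc ∫⁻ t in Ico a (2 * a), c / ENNReal.ofReal t
      ≤ ∫⁻ _t in Ico a (2 * a), c / ENNReal.ofReal a :=
        setLIntegral_mono' measurableSet_Ico fun t ht => by
          gcongr
          exact ht.1
    _ = c := by
        rw [setLIntegral_const, Real.volume_Ico, two_mul, add_sub_cancel_right]
        exact ENNReal.div_mul_cancel (by simpa using ha) ENNReal.ofReal_ne_top

lemma Ioo_subset_iUnion_Ico_div_pow (a : ℝ) :
    Ioo 0 (2 * a) ⊆ ⋃ k : ℕ, Ico (a / 2 ^ k) (2 * (a / 2 ^ k)) := by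
  rintro t ⟨ht, hta⟩
  have hex : ∃ k : ℕ, a / 2 ^ k ≤ t := by
    obtain ⟨k, hk⟩ := pow_unbounded_of_one_lt (a / t) one_lt_two
    exact ⟨k, (div_le_comm₀ (by positivity) ht).2 hk.le⟩
  classical
  refine mem_iUnion.2 ⟨Nat.find hex, Nat.find_spec hex, ?_⟩
  rcases hk : Nat.find hex with _ | k
  · simpa using hta
  · have hlt : t < a / 2 ^ k := not_le.1 (Nat.find_min hex (hk ▸ k.lt_succ_self))
    rwa [pow_succ, ← div_div, mul_div_cancel₀ _ two_ne_zero]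

lemma lintegral_Ioo_supConv_le_sum_geomSq (hα : 0 < α) (hL : 0 < L) (hfm : Measurable f)
    (hf : Integrable f) (x : EuclideanSpace ℝ (Fin n)) :
    ∫⁻ t in Ioo 0 (L / 7), supConv α f x t ^ (2 : ℕ) / ENNReal.ofReal t ≤
      gridConst n α ^ 2 * ∑ ω : Fin n → Bool,
        (dyadicGrid hL fun i => boolShift (L / 3) (ω i)).geomSq (decay α) f x := by
  have hcover : Ioo 0 (L / 7) ⊆ ⋃ k : ℕ, Ico (L / 14 / 2 ^ k) (2 * (L / 14 / 2 ^ k)) := by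
    convert Ioo_subset_iUnion_Ico_div_pow (L / 14) using 2
    ring
  calc ∫⁻ t in Ioo 0 (L / 7), supConv α f x t ^ (2 : ℕ) / ENNReal.ofReal t
      ≤ ∫⁻ t in ⋃ k : ℕ, Ico (L / 14 / 2 ^ k) (2 * (L / 14 / 2 ^ k)),
          supConv α f x t ^ (2 : ℕ) / ENNReal.ofReal t := lintegral_mono_set hcover
    _ ≤ ∑' k : ℕ, ∫⁻ t in Ico (L / 14 / 2 ^ k) (2 * (L / 14 / 2 ^ k)),
          supConv α f x t ^ (2 : ℕ) / ENNReal.ofReal t := lintegral_iUnion_le _ _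
    _ ≤ ∑' k : ℕ, gridConst n α ^ 2 * ∑ ω : Fin n → Bool,
          let F := dyadicGrid hL fun i => boolShift (L / 3) (ω i)
          (∑' m, decay α ^ (2 * m) * F.lmean k (‖F.diff (k + m) f ·‖ₑ) x) ^ 2 := by
        refine ENNReal.tsum_le_tsum fun k => ?_
        have hside : L / 14 / 2 ^ k = L / 2 ^ k / 14 := div_right_comm _ _ _
        have hk : 0 < L / 2 ^ k := by positivity
        refine (setLIntegral_mono' measurableSet_Ico fun t ht => ?_).trans
          (lintegral_Ico_div_le (by positivity) _)
        rw [hside] at ht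
        gcongr
        exact supConv_sq_le_sum_dyadicGrid hα hL hfm hf (lt_of_lt_of_le (by positivity) ht.1)
          (by linarith [ht.1]) (by linarith [ht.2])
    _ = _ := by
        rw [ENNReal.tsum_mul_left, Summable.tsum_finsetSum fun _ _ => ENNReal.summable]
        rfl

end GridDomination

section LpBound

variable {n : ℕ} {α p : ℝ} {𝕜 : Type*} [RCLike 𝕜]

lemma sum_rpow_le_card_rpow_mul_sum {ι : Type*} (s : Finset ι) (b : ι → ℝ≥0∞) {r : ℝ}
    (hr : 0 < r) : (∑ i ∈ s, b i) ^ r ≤ (s.card : ℝ≥0∞) ^ r * ∑ i ∈ s, b i ^ r := by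
  have hb : ∀ i ∈ s, b i ≤ (∑ i ∈ s, b i ^ r) ^ r⁻¹ := fun i hi =>
    (ENNReal.le_rpow_inv_iff hr).2
      (Finset.single_le_sum (f := fun i => b i ^ r) (fun _ _ => zero_le) hi)
  calc (∑ i ∈ s, b i) ^ r ≤ (s.card * (∑ i ∈ s, b i ^ r) ^ r⁻¹) ^ r := by
        refine ENNReal.rpow_le_rpow ((Finset.sum_le_card_nsmul _ _ _ hb).trans_eq ?_) hr.le
        rw [nsmul_eq_mul]
    _ = _ := by rw [ENNReal.mul_rpow_of_nonneg _ _ hr.le, ENNReal.rpow_inv_rpow hr.ne']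

variable (n) in
lemma exists_lintegral_Ioo_supConv_rpow_le [NeZero n] (hα : 0 < α) (hp : 1 < p) :
    ∃ C : ℝ≥0, ∀ f : EuclideanSpace ℝ (Fin n) → ℝ, Measurable f → Integrable f → (∀ x, 0 ≤ f x) →
      ∫⁻ x, ‖f x‖ₑ ^ p < ∞ → ∀ R, 0 < R →
        ∫⁻ x, (∫⁻ t in Ioo 0 R, supConv α f x t ^ (2 : ℕ) / ENNReal.ofReal t) ^ (p / 2) ≤
          C * ∫⁻ x, ‖f x‖ₑ ^ p := by
  have hp0 : 0 < p / 2 := by linarith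
  obtain ⟨C, hC⟩ := CellFiltration.exists_lintegral_geomSq_rpow_le
    (volume : Measure (EuclideanSpace ℝ (Fin n))) (Fin n → ℤ) (D := 2 ^ n) (by positivity) hp
    (decay_lt_one hα)
  set N := Fintype.card (Fin n → Bool)
  have hK : (gridConst n α ^ 2) ^ (p / 2) * ((N : ℝ≥0∞) ^ (p / 2) * (N * C)) ≠ ∞ := by
    have : gridConst n α ≠ ∞ := ENNReal.ofReal_ne_top
    finiteness
  refine ⟨((gridConst n α ^ 2) ^ (p / 2) * ((N : ℝ≥0∞) ^ (p / 2) * (N * C))).toNNReal,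
    fun f hfm hf h0 hfin R hR => ?_⟩
  have hL : 0 < 7 * R := by positivity
  set F := fun ω : Fin n → Bool => dyadicGrid hL fun i => boolShift (7 * R / 3) (ω i)
  have hF := fun ω => (F ω).measurable_geomSq (decay α) f
  calc ∫⁻ x, (∫⁻ t in Ioo 0 R, supConv α f x t ^ (2 : ℕ) / ENNReal.ofReal t) ^ (p / 2)
      ≤ ∫⁻ x, (gridConst n α ^ 2) ^ (p / 2) *
          ((N : ℝ≥0∞) ^ (p / 2) * ∑ ω, (F ω).geomSq (decay α) f x ^ (p / 2)) := by
        refine lintegral_mono fun x => ?_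
        have hgrid := lintegral_Ioo_supConv_le_sum_geomSq hα hL hfm hf x
        rw [mul_div_cancel_left₀ R (by norm_num)] at hgrid
        refine (ENNReal.rpow_le_rpow hgrid hp0.le).trans ?_
        rw [ENNReal.mul_rpow_of_nonneg _ _ hp0.le]
        gcongr
        exact sum_rpow_le_card_rpow_mul_sum _ _ hp0
    _ = (gridConst n α ^ 2) ^ (p / 2) *
          ((N : ℝ≥0∞) ^ (p / 2) * ∑ ω, ∫⁻ x, (F ω).geomSq (decay α) f x ^ (p / 2)) := by
        rw [lintegral_const_mul _ (by fun_prop), lintegral_const_mul _ (by fun_prop),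
          lintegral_finsetSum _ fun ω _ => by fun_prop]
    _ ≤ (gridConst n α ^ 2) ^ (p / 2) *
          ((N : ℝ≥0∞) ^ (p / 2) * ∑ _ω : Fin n → Bool, C * ∫⁻ x, ‖f x‖ₑ ^ p) := by
        gcongr with ω
        exact hC (F ω) f hfm hf h0 hfin
    _ = _ := by
        rw [ENNReal.coe_toNNReal hK, Finset.sum_const, Finset.card_univ, nsmul_eq_mul]
        ring

lemma gFun_rpow (α p : ℝ) (f : EuclideanSpace ℝ (Fin n) → 𝕜) (x : EuclideanSpace ℝ (Fin n)) :
    gFun α f x ^ p =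
      (∫⁻ t in Ioi 0, supConv α f x t ^ (2 : ℕ) / ENNReal.ofReal t) ^ (p / 2) := by
  rw [gFun, ← ENNReal.rpow_mul, one_div_mul_eq_div]

lemma lintegral_gFun_rpow_le_of_Ioo [NeZero n] (hα : 0 < α) (hp : 0 ≤ p)
    {f : EuclideanSpace ℝ (Fin n) → 𝕜} (hf : LocallyIntegrable f) {B : ℝ≥0∞}
    (hB : ∀ R, 0 < R →
      ∫⁻ x, (∫⁻ t in Ioo 0 R, supConv α f x t ^ (2 : ℕ) / ENNReal.ofReal t) ^ (p / 2) ≤ B) :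
    ∫⁻ x, gFun α f x ^ p ≤ B := by
  have hp0 : 0 ≤ p / 2 := by linarith
  have hmono : Monotone fun N : ℕ => Ioo (0 : ℝ) (N + 1) := fun M N h =>
    Ioo_subset_Ioo_right (by gcongr)
  have hunion : ⋃ N : ℕ, Ioo (0 : ℝ) (N + 1) = Ioi 0 := by
    refine subset_antisymm (iUnion_subset fun _ => Ioo_subset_Ioi_self) fun t ht => ?_
    obtain ⟨N, hN⟩ := exists_nat_gt t
    exact mem_iUnion.2 ⟨N, ht, hN.trans (lt_add_one _)⟩
  have hlim : ∀ x, Tendsto (fun N : ℕ => (∫⁻ t in Ioo (0 : ℝ) (N + 1),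
      supConv α f x t ^ (2 : ℕ) / ENNReal.ofReal t) ^ (p / 2)) atTop (𝓝 (gFun α f x ^ p)) := by
    intro x
    rw [gFun_rpow, ← hunion, setLIntegral_iUnion_of_directed _ hmono.directed_le]
    exact (ENNReal.continuous_rpow_const.tendsto _).comp
      (tendsto_atTop_iSup fun M N h => lintegral_mono_set (hmono h))
  exact le_of_tendsto' (lintegral_tendsto_of_tendsto_of_monotone
    (fun N => ((measurable_setLIntegral_supConv hα hf measurableSet_Ioo
      Ioo_subset_Ioi_self).pow_const _).aemeasurable)
    (ae_of_all _ fun x M N h => ENNReal.rpow_le_rpow (lintegral_mono_set (hmono h)) hp0)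
    (ae_of_all _ hlim)) fun N => hB _ (by positivity)

lemma lintegral_gFun_rpow_le_of_supConv_le [NeZero n] {𝕜' : Type*} [RCLike 𝕜'] (hα : 0 < α)
    (hp : 1 ≤ p) {u v : EuclideanSpace ℝ (Fin n) → 𝕜} {w : EuclideanSpace ℝ (Fin n) → 𝕜'}
    (hu : LocallyIntegrable u) (hv : LocallyIntegrable v)
    (hle : ∀ x t, 0 < t → supConv α w x t ≤ supConv α u x t + supConv α v x t) {B : ℝ≥0∞}
    (huB : ∫⁻ x, gFun α u x ^ p ≤ B) (hvB : ∫⁻ x, gFun α v x ^ p ≤ B) :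
    ∫⁻ x, gFun α w x ^ p ≤ 2 ^ p * B := by
  calc ∫⁻ x, gFun α w x ^ p
      ≤ 2 ^ (p - 1) * ((∫⁻ x, gFun α u x ^ p) + ∫⁻ x, gFun α v x ^ p) :=
        lintegral_rpow_le_of_le_add (measurable_gFun hα hu).aemeasurable
          (fun x => gFun_le_add_of_supConv_le hα hu hv (hle x)) hp
    _ ≤ 2 ^ (p - 1) * (B + B) := by gcongr
    _ = 2 ^ p * B := by rw [← two_mul, ← mul_assoc, rpow_sub_one_mul_self hp]

lemma supConv_neg (f : EuclideanSpace ℝ (Fin n) → 𝕜) : supConv α (-f) = supConv α f := by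
  funext x t
  simp only [supConv, Pi.neg_apply, smul_neg, integral_neg, enorm_neg]

lemma enorm_le_enorm_re_add_enorm_im (z : 𝕜) : ‖z‖ₑ ≤ ‖RCLike.re z‖ₑ + ‖RCLike.im z‖ₑ := by
  calc ‖z‖ₑ = ‖(RCLike.re z : 𝕜) + RCLike.im z * RCLike.I‖ₑ := by rw [RCLike.re_add_im]
    _ ≤ ‖(RCLike.re z : 𝕜)‖ₑ + ‖(RCLike.im z : 𝕜) * RCLike.I‖ₑ := enorm_add_le _ _
    _ ≤ ‖RCLike.re z‖ₑ + ‖RCLike.im z‖ₑ := by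
        refine add_le_add (enorm_le_iff_norm_le.2 (RCLike.norm_ofReal _).le)
          (enorm_le_iff_norm_le.2 ?_)
        rw [norm_mul, RCLike.norm_ofReal, RCLike.norm_I]
        exact mul_le_of_le_one_right (abs_nonneg _) (by split_ifs <;> norm_num)

variable (n) in
lemma exists_lintegral_gFun_rpow_le_real [NeZero n] (hα : 0 < α) (hp : 1 < p) :
    ∃ C : ℝ≥0, ∀ f : EuclideanSpace ℝ (Fin n) → ℝ, Integrable f →
      ∫⁻ x, ‖f x‖ₑ ^ p < ∞ → ∫⁻ x, gFun α f x ^ p ≤ C * ∫⁻ x, ‖f x‖ₑ ^ p := by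
  have hp0 : 0 ≤ p := by linarith
  obtain ⟨C, hC⟩ := exists_lintegral_Ioo_supConv_rpow_le n hα hp
  refine ⟨2 ^ p * C, fun f hf hfin => ?_⟩
  push_cast [ENNReal.coe_rpow_of_nonneg _ hp0]
  rw [mul_assoc]
  set g := hf.1.mk f
  have hfg : f =ᵐ[volume] g := hf.1.ae_eq_mk
  have hgm : Measurable g := hf.1.stronglyMeasurable_mk.measurable
  have hpart : ∀ h : EuclideanSpace ℝ (Fin n) → ℝ, Measurable h → Integrable h →
      (∀ x, 0 ≤ h x) → (∀ x, ‖h x‖ₑ ≤ ‖g x‖ₑ) →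
        ∫⁻ x, gFun α h x ^ p ≤ C * ∫⁻ x, ‖f x‖ₑ ^ p := by
    intro h hm hi h0 hle
    have hpow : ∫⁻ x, ‖h x‖ₑ ^ p ≤ ∫⁻ x, ‖f x‖ₑ ^ p :=
      lintegral_mono_ae (hfg.mono fun x hx => by
        rw [hx]
        exact ENNReal.rpow_le_rpow (hle x) hp0)
    exact (lintegral_gFun_rpow_le_of_Ioo hα hp0 hi.locallyIntegrable
      (hC h hm hi h0 (hpow.trans_lt hfin))).trans (by gcongr)
  have hbound : ∀ a : ℝ, ‖max a 0‖ₑ ≤ ‖a‖ₑ := fun a =>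
    enorm_le_iff_norm_le.2 (by simpa using abs_max_le_max_abs_abs (a := a) (b := 0))
  have hgi : Integrable g := hf.congr hfg
  refine lintegral_gFun_rpow_le_of_supConv_le hα hp.le hgi.pos_part.locallyIntegrable
    hgi.neg_part.locallyIntegrable (fun x t ht => ?_)
    (hpart _ (by fun_prop) hgi.pos_part (fun _ => le_max_right _ _) fun x => hbound (g x))
    (hpart _ (by fun_prop) hgi.neg_part (fun _ => le_max_right _ _) fun x =>
      (hbound (-g x)).trans_eq (enorm_neg _))
  have hparts : g = (fun x => max (g x) 0) + -fun x => max (-g x) 0 :=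
    funext fun x => (max_zero_sub_max_neg_zero_eq_self (g x)).symm.trans (sub_eq_add_neg _ _)
  calc supConv α f x t = supConv α ((fun x => max (g x) 0) + -fun x => max (-g x) 0) x t := by
        rw [supConv_congr_ae hfg, ← hparts]
    _ ≤ _ := supConv_add_le hα ht x hgi.pos_part.locallyIntegrable
        hgi.neg_part.locallyIntegrable.neg
    _ = _ := by rw [supConv_neg]

lemma supConv_le_supConv_re_add_supConv_im (hα : 0 < α) {t : ℝ} (ht : 0 < t)
    (x : EuclideanSpace ℝ (Fin n)) {f : EuclideanSpace ℝ (Fin n) → 𝕜} (hf : LocallyIntegrable f) :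
    supConv α f x t ≤
      supConv α (fun x => RCLike.re (f x)) x t + supConv α (fun x => RCLike.im (f x)) x t := by
  refine iSup₂_le fun φ hφ => ?_
  have hi := integrable_dilate_sub_smul hφ hα ht x hf
  calc ‖∫ z, dilate φ t (x - z) • f z‖ₑ
      ≤ ‖RCLike.re (∫ z, dilate φ t (x - z) • f z)‖ₑ +
          ‖RCLike.im (∫ z, dilate φ t (x - z) • f z)‖ₑ := enorm_le_enorm_re_add_enorm_im _
    _ = ‖∫ z, dilate φ t (x - z) • RCLike.re (f z)‖ₑ +
          ‖∫ z, dilate φ t (x - z) • RCLike.im (f z)‖ₑ := by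
        rw [← integral_re hi, ← integral_im hi]
        simp only [RCLike.smul_re, RCLike.smul_im, smul_eq_mul]
    _ ≤ _ := add_le_add (enorm_integral_dilate_le_supConv hφ _ x t)
        (enorm_integral_dilate_le_supConv hφ _ x t)

variable (n 𝕜) in
theorem exists_lintegral_gFun_rpow_le [NeZero n] (hα : 0 < α) (hp : 1 < p) :
    ∃ C : ℝ≥0, ∀ f : EuclideanSpace ℝ (Fin n) → 𝕜, Integrable f →
      ∫⁻ x, ‖f x‖ₑ ^ p < ∞ → ∫⁻ x, gFun α f x ^ p ≤ C * ∫⁻ x, ‖f x‖ₑ ^ p := by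
  have hp0 : 0 ≤ p := by linarith
  obtain ⟨C, hC⟩ := exists_lintegral_gFun_rpow_le_real n hα hp
  refine ⟨2 ^ p * C, fun f hf hfin => ?_⟩
  push_cast [ENNReal.coe_rpow_of_nonneg _ hp0]
  rw [mul_assoc]
  have hpart : ∀ h : EuclideanSpace ℝ (Fin n) → ℝ, Integrable h → (∀ x, ‖h x‖ₑ ≤ ‖f x‖ₑ) →
      ∫⁻ x, gFun α h x ^ p ≤ C * ∫⁻ x, ‖f x‖ₑ ^ p := by
    intro h hi hle
    have hpow : ∫⁻ x, ‖h x‖ₑ ^ p ≤ ∫⁻ x, ‖f x‖ₑ ^ p :=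
      lintegral_mono fun x => ENNReal.rpow_le_rpow (hle x) hp0
    exact (hC h hi (hpow.trans_lt hfin)).trans (by gcongr)
  exact lintegral_gFun_rpow_le_of_supConv_le hα hp.le hf.re.locallyIntegrable
    hf.im.locallyIntegrable
    (fun x t ht => supConv_le_supConv_re_add_supConv_im hα ht x hf.locallyIntegrable)
    (hpart _ hf.re fun x => enorm_le_iff_norm_le.2 (RCLike.norm_re_le_norm _))
    (hpart _ hf.im fun x => enorm_le_iff_norm_le.2 (RCLike.norm_im_le_norm _))

end LpBound

/-! ### Morrey spaces -/

section Morrey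

variable {n : ℕ} {α p D : ℝ} {Φ : ℝ → ℝ} {𝕜 : Type*} [RCLike 𝕜]

lemma le_pow_mul_of_doubling (hD : 0 ≤ D) (hΦ : ∀ r, 0 < r → Φ (2 * r) ≤ D * Φ r) {r : ℝ}
    (hr : 0 < r) (j : ℕ) : Φ (2 ^ j * r) ≤ D ^ j * Φ r := by
  induction j with
  | zero => simp
  | succ j ih =>
    calc Φ (2 ^ (j + 1) * r) = Φ (2 * (2 ^ j * r)) := by rw [pow_succ']; ring_nf
      _ ≤ D * Φ (2 ^ j * r) := hΦ _ (by positivity)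
      _ ≤ D * (D ^ j * Φ r) := by gcongr
      _ = D ^ (j + 1) * Φ r := by ring

/-- `C` is an upper bound for the Morrey norm of `f`; `morreyNorm p Φ f` is the infimum of these
constants. -/
def IsMorreyBound {ε : Type*} [ENorm ε] (p : ℝ) (Φ : ℝ → ℝ) (f : EuclideanSpace ℝ (Fin n) → ε)
    (C : ℝ≥0∞) : Prop :=
  ∀ (x₀ : EuclideanSpace ℝ (Fin n)) (r : ℝ), 0 < r →
    ∫⁻ x in Metric.ball x₀ r, ‖f x‖ₑ ^ p ≤ C ^ p * ENNReal.ofReal (Φ r)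

namespace IsMorreyBound

lemma mono {ε ε' : Type*} [ENorm ε] [ENorm ε'] {f : EuclideanSpace ℝ (Fin n) → ε}
    {g : EuclideanSpace ℝ (Fin n) → ε'} {C : ℝ≥0∞} (hf : IsMorreyBound p Φ f C) (hp : 0 ≤ p)
    (hgf : ∀ x, ‖g x‖ₑ ≤ ‖f x‖ₑ) : IsMorreyBound p Φ g C := fun x₀ r hr =>
  (lintegral_mono fun x => ENNReal.rpow_le_rpow (hgf x) hp).trans (hf x₀ r hr)

lemma setLIntegral_ball_pow_le {ε : Type*} [ENorm ε] {f : EuclideanSpace ℝ (Fin n) → ε}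
    {C : ℝ≥0∞} (hf : IsMorreyBound p Φ f C) (hD : 0 ≤ D)
    (hΦ : ∀ r, 0 < r → Φ (2 * r) ≤ D * Φ r) (x₀ : EuclideanSpace ℝ (Fin n)) {r : ℝ} (hr : 0 < r)
    (j : ℕ) : ∫⁻ x in Metric.ball x₀ (2 ^ j * r), ‖f x‖ₑ ^ p ≤
      ENNReal.ofReal D ^ j * (C ^ p * ENNReal.ofReal (Φ r)) := by
  calc ∫⁻ x in Metric.ball x₀ (2 ^ j * r), ‖f x‖ₑ ^ p
      ≤ C ^ p * ENNReal.ofReal (Φ (2 ^ j * r)) := hf x₀ _ (by positivity)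
    _ ≤ C ^ p * ENNReal.ofReal (D ^ j * Φ r) := by
        gcongr
        exact le_pow_mul_of_doubling hD hΦ hr j
    _ = ENNReal.ofReal D ^ j * (C ^ p * ENNReal.ofReal (Φ r)) := by
        rw [ENNReal.ofReal_mul (by positivity), ENNReal.ofReal_pow hD]
        ring

lemma locallyIntegrable {ε : Type*} [TopologicalSpace ε] [ContinuousENorm ε]
    {f : EuclideanSpace ℝ (Fin n) → ε} {C : ℝ≥0∞} (hf : IsMorreyBound p Φ f C) (hC : C ≠ ∞)
    (hp : 1 ≤ p) (hfm : AEStronglyMeasurable f) : LocallyIntegrable f := by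
  have hp0 : 0 < p := zero_lt_one.trans_le hp
  intro x
  have : IsFiniteMeasure (volume.restrict (Metric.ball x 1)) := ⟨by simpa using measure_ball_lt_top⟩
  have hLp : MemLp f (ENNReal.ofReal p) (volume.restrict (Metric.ball x 1)) := by
    refine ⟨hfm.restrict, (eLpNorm_lt_top_iff_lintegral_rpow_enorm_lt_top (by simpa)
      ENNReal.ofReal_ne_top).2 ?_⟩
    rw [ENNReal.toReal_ofReal hp0.le]
    exact (hf x 1 one_pos).trans_lt (ENNReal.mul_lt_top
      (ENNReal.rpow_lt_top_of_nonneg hp0.le hC) ENNReal.ofReal_lt_top)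
  exact ⟨Metric.ball x 1, Metric.ball_mem_nhds x one_pos,
    hLp.integrable (by simpa using ENNReal.ofReal_le_ofReal hp)⟩

end IsMorreyBound

lemma supConv_rpow_le [NeZero n] (hα : 0 < α) (hp : 1 ≤ p) {f : EuclideanSpace ℝ (Fin n) → 𝕜}
    (hf : LocallyIntegrable f) (x : EuclideanSpace ℝ (Fin n)) {t : ℝ} (ht : 0 < t) :
    supConv α f x t ^ p ≤ volume (Metric.ball (0 : EuclideanSpace ℝ (Fin n)) 1) ^ p *
      ⨍⁻ z in Metric.closedBall x t, ‖f z‖ₑ ^ p ∂volume := by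
  have hp0 : 0 ≤ p := zero_le_one.trans hp
  calc supConv α f x t ^ p
      ≤ (volume (Metric.ball (0 : EuclideanSpace ℝ (Fin n)) 1) *
          ⨍⁻ z in Metric.closedBall x t, ‖f z‖ₑ ∂volume) ^ p :=
        ENNReal.rpow_le_rpow (supConv_le_setLAverage hα ht f x) hp0
    _ ≤ _ := by
        rw [ENNReal.mul_rpow_of_nonneg _ _ hp0]
        gcongr
        exact rpow_setLAverage_le hf.aestronglyMeasurable.restrict.enorm
          measure_closedBall_lt_top.ne hp

lemma IsMorreyBound.setLAverage_closedBall_le {ε : Type*} [ENorm ε]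
    {f : EuclideanSpace ℝ (Fin n) → ε} {C : ℝ≥0∞} (hf : IsMorreyBound p Φ f C) (hD : 0 ≤ D)
    (hΦ : ∀ r, 0 < r → Φ (2 * r) ≤ D * Φ r) {x₀ x : EuclideanSpace ℝ (Fin n)} {r : ℝ} (hr : 0 < r)
    (hx : x ∈ Metric.ball x₀ r) (j : ℕ) {t : ℝ} (ht : t ∈ Ico (2 ^ j * r) (2 * (2 ^ j * r))) :
    ⨍⁻ z in Metric.closedBall x t, ‖f z‖ₑ ^ p ∂volume ≤
      ENNReal.ofReal D ^ (j + 2) * (C ^ p * ENNReal.ofReal (Φ r)) /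
        (ENNReal.ofReal (2 ^ j * r) ^ n *
          volume (Metric.ball (0 : EuclideanSpace ℝ (Fin n)) 1)) := by
  have hsub : Metric.closedBall x t ⊆ Metric.ball x₀ (2 ^ (j + 2) * r) := by
    refine Metric.closedBall_subset_ball' ?_
    have := one_le_pow₀ (n := j) (one_le_two (α := ℝ))
    rw [Metric.mem_ball] at hx
    rw [pow_add]
    nlinarith [ht.2]
  have hvol : ENNReal.ofReal (2 ^ j * r) ^ n *
      volume (Metric.ball (0 : EuclideanSpace ℝ (Fin n)) 1) ≤ volume (Metric.closedBall x t) := by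
    have ht0 : 0 ≤ t := le_trans (by positivity) ht.1
    rw [Measure.addHaar_closedBall _ _ ht0, finrank_euclideanSpace_fin, ENNReal.ofReal_pow ht0]
    gcongr
    exact ht.1
  rw [setLAverage_eq]
  exact ENNReal.div_le_div
    ((lintegral_mono_set hsub).trans (hf.setLIntegral_ball_pow_le hD hΦ x₀ hr _)) hvol

lemma supConv_rpow_le_of_isMorreyBound [NeZero n] (hα : 0 < α) (hp : 1 ≤ p) (hD : 0 ≤ D)
    (hΦ : ∀ r, 0 < r → Φ (2 * r) ≤ D * Φ r) {f : EuclideanSpace ℝ (Fin n) → 𝕜}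
    (hf : LocallyIntegrable f) {C : ℝ≥0∞} (hC : IsMorreyBound p Φ f C)
    {x₀ x : EuclideanSpace ℝ (Fin n)} {r : ℝ} (hr : 0 < r) (hx : x ∈ Metric.ball x₀ r) (j : ℕ)
    {t : ℝ} (ht : t ∈ Ico (2 ^ j * r) (2 * (2 ^ j * r))) :
    supConv α f x t ^ p ≤ volume (Metric.ball (0 : EuclideanSpace ℝ (Fin n)) 1) ^ (p - 1) *
      ENNReal.ofReal D ^ 2 * (C ^ p * ENNReal.ofReal (Φ r) / ENNReal.ofReal r ^ n) *
        ENNReal.ofReal (D / 2 ^ n) ^ j := by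
  set v := volume (Metric.ball (0 : EuclideanSpace ℝ (Fin n)) 1)
  set M := C ^ p * ENNReal.ofReal (Φ r)
  have hv0 : v ≠ 0 := (Metric.measure_ball_pos volume 0 one_pos).ne'
  have hvt : v ≠ ∞ := measure_ball_lt_top.ne
  have ht0 : 0 < t := lt_of_lt_of_le (by positivity) ht.1
  calc supConv α f x t ^ p
      ≤ v ^ p * (ENNReal.ofReal D ^ (j + 2) * M / (ENNReal.ofReal (2 ^ j * r) ^ n * v)) :=
        (supConv_rpow_le hα hp hf x ht0).trans <| by
          gcongr
          exact hC.setLAverage_closedBall_le hD hΦ hr hx j ht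
    _ = _ := by
        have h2 : (2 ^ n : ℝ≥0∞) ≠ ∞ := ENNReal.pow_ne_top (by simp)
        rw [ENNReal.rpow_sub _ _ hv0 hvt, ENNReal.rpow_one,
          ENNReal.ofReal_div_of_pos (by positivity), ENNReal.ofReal_pow zero_le_two,
          ENNReal.ofReal_mul (by positivity), ENNReal.ofReal_pow zero_le_two, ENNReal.ofReal_ofNat,
          mul_pow, ← pow_mul, mul_comm j, pow_mul]
        simp only [div_eq_mul_inv, mul_pow]
        rw [ENNReal.mul_inv (Or.inr hvt) (Or.inr hv0), ENNReal.mul_inv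
          (Or.inl (by positivity)) (Or.inl (ENNReal.pow_ne_top h2)), ENNReal.inv_pow]
        ring

lemma lintegral_Ioi_div_le_tsum {r : ℝ} (hr : 0 < r) {u : ℝ → ℝ≥0∞} {c : ℕ → ℝ≥0∞}
    (h0 : ∀ t ∈ Ioo 0 r, u t = 0)
    (hc : ∀ j : ℕ, ∀ t ∈ Ico (2 ^ j * r) (2 * (2 ^ j * r)), u t ≤ c j) :
    ∫⁻ t in Ioi 0, u t / ENNReal.ofReal t ≤ ∑' j, c j := by
  have hcover : Ioi (0 : ℝ) ⊆ Ioo 0 r ∪ ⋃ j : ℕ, Ico (2 ^ j * r) (2 * (2 ^ j * r)) := by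
    intro t ht
    rcases lt_or_ge t r with htr | htr
    · exact Or.inl ⟨ht, htr⟩
    · obtain ⟨j, hj, hj'⟩ := exists_nat_pow_near (y := 2) ((one_le_div hr).2 htr) one_lt_two
      rw [div_lt_iff₀ hr, pow_succ', mul_assoc] at hj'
      exact Or.inr (mem_iUnion.2 ⟨j, (le_div_iff₀ hr).1 hj, hj'⟩)
  have hnear : ∫⁻ t in Ioo 0 r, u t / ENNReal.ofReal t = 0 := by
    rw [setLIntegral_congr_fun (g := 0) measurableSet_Ioo fun t ht => by simp [h0 t ht]]
    exact lintegral_zero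
  calc ∫⁻ t in Ioi 0, u t / ENNReal.ofReal t
      ≤ ∫⁻ t in Ioo 0 r ∪ ⋃ j : ℕ, Ico (2 ^ j * r) (2 * (2 ^ j * r)), u t / ENNReal.ofReal t :=
        lintegral_mono_set hcover
    _ ≤ ∫⁻ t in ⋃ j : ℕ, Ico (2 ^ j * r) (2 * (2 ^ j * r)), u t / ENNReal.ofReal t :=
        (lintegral_union_le _ _ _).trans_eq (by rw [hnear, zero_add])
    _ ≤ ∑' j : ℕ, ∫⁻ t in Ico (2 ^ j * r) (2 * (2 ^ j * r)), u t / ENNReal.ofReal t :=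
        lintegral_iUnion_le _ _
    _ ≤ ∑' j, c j := ENNReal.tsum_le_tsum fun j =>
        (setLIntegral_mono' measurableSet_Ico fun t ht => by gcongr; exact hc j t ht).trans
          (lintegral_Ico_div_le (by positivity) _)

lemma supConv_eq_zero [NeZero n] (hα : 0 < α) {f : EuclideanSpace ℝ (Fin n) → 𝕜}
    {x : EuclideanSpace ℝ (Fin n)} {t : ℝ} (ht : 0 < t)
    (hf0 : ∀ z ∈ Metric.closedBall x t, f z = 0) : supConv α f x t = 0 := by
  have havg : ⨍⁻ z in Metric.closedBall x t, ‖f z‖ₑ ∂volume = 0 := by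
    rw [setLAverage_congr_fun (g := 0) Metric.isClosed_closedBall.measurableSet
      (fun z hz => by simp [hf0 z hz])]
    exact laverage_zero _
  simpa [havg] using supConv_le_setLAverage hα ht f x

lemma gFun_rpow_le_of_isMorreyBound [NeZero n] (hα : 0 < α) (hp : 1 ≤ p) (hD : 0 ≤ D)
    (hΦ : ∀ r, 0 < r → Φ (2 * r) ≤ D * Φ r) {f : EuclideanSpace ℝ (Fin n) → 𝕜}
    (hf : LocallyIntegrable f) {C : ℝ≥0∞} (hC : IsMorreyBound p Φ f C)
    {x₀ x : EuclideanSpace ℝ (Fin n)} {r : ℝ} (hr : 0 < r) (hx : x ∈ Metric.ball x₀ r)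
    (hf0 : ∀ z ∈ Metric.ball x₀ (2 * r), f z = 0) :
    gFun α f x ^ p ≤ volume (Metric.ball (0 : EuclideanSpace ℝ (Fin n)) 1) ^ (p - 1) *
      ENNReal.ofReal D ^ 2 * (C ^ p * ENNReal.ofReal (Φ r) / ENNReal.ofReal r ^ n) *
        (1 - ENNReal.ofReal (D / 2 ^ n) ^ (2 / p))⁻¹ ^ (p / 2) := by
  have hp0 : 0 < p := zero_lt_one.trans_le hp
  set A := volume (Metric.ball (0 : EuclideanSpace ℝ (Fin n)) 1) ^ (p - 1) *
    ENNReal.ofReal D ^ 2 * (C ^ p * ENNReal.ofReal (Φ r) / ENNReal.ofReal r ^ n)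
  set q := ENNReal.ofReal (D / 2 ^ n)
  have hsmall : ∀ t ∈ Ioo 0 r, supConv α f x t ^ 2 = 0 := by
    intro t ht
    have hsub : Metric.closedBall x t ⊆ Metric.ball x₀ (2 * r) :=
      Metric.closedBall_subset_ball' (by linarith [ht.2, Metric.mem_ball.1 hx])
    simp [supConv_eq_zero hα ht.1 fun z hz => hf0 z (hsub hz)]
  have hlarge : ∀ j : ℕ, ∀ t ∈ Ico (2 ^ j * r) (2 * (2 ^ j * r)),
      supConv α f x t ^ 2 ≤ A ^ (2 / p) * (q ^ (2 / p)) ^ j := by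
    intro j t ht
    calc supConv α f x t ^ 2 = (supConv α f x t ^ p) ^ (2 / p) := by
          rw [← ENNReal.rpow_mul, mul_div_cancel₀ _ hp0.ne', ENNReal.rpow_two]
      _ ≤ (A * q ^ j) ^ (2 / p) := ENNReal.rpow_le_rpow
          (supConv_rpow_le_of_isMorreyBound hα hp hD hΦ hf hC hr hx j ht) (by positivity)
      _ = _ := by
          rw [ENNReal.mul_rpow_of_nonneg _ _ (by positivity), ← ENNReal.rpow_natCast_mul,
            ← ENNReal.rpow_mul_natCast, mul_comm (j : ℝ)]
  calc gFun α f x ^ p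
      = (∫⁻ t in Ioi 0, supConv α f x t ^ 2 / ENNReal.ofReal t) ^ (p / 2) := gFun_rpow _ _ _ _
    _ ≤ (A ^ (2 / p) * (1 - q ^ (2 / p))⁻¹) ^ (p / 2) := by
        refine ENNReal.rpow_le_rpow ((lintegral_Ioi_div_le_tsum hr hsmall hlarge).trans_eq ?_)
          (by positivity)
        rw [ENNReal.tsum_mul_left, ENNReal.tsum_geometric]
    _ = A * (1 - q ^ (2 / p))⁻¹ ^ (p / 2) := by
        rw [ENNReal.mul_rpow_of_nonneg _ _ (by positivity), ← ENNReal.rpow_mul,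
          div_mul_div_cancel₀ hp0.ne', div_self two_ne_zero, ENNReal.rpow_one]

lemma exists_setLIntegral_gFun_rpow_le_of_eq_zero [NeZero n] (hα : 0 < α) (hp : 1 ≤ p)
    (hD : 0 ≤ D) (hDn : D < 2 ^ n) :
    ∃ K : ℝ≥0, ∀ Φ : ℝ → ℝ, (∀ r, 0 < r → Φ (2 * r) ≤ D * Φ r) →
      ∀ f : EuclideanSpace ℝ (Fin n) → 𝕜, LocallyIntegrable f →
      ∀ C, IsMorreyBound p Φ f C → ∀ x₀ r, 0 < r → (∀ z ∈ Metric.ball x₀ (2 * r), f z = 0) →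
        ∫⁻ x in Metric.ball x₀ r, gFun α f x ^ p ≤ K * (C ^ p * ENNReal.ofReal (Φ r)) := by
  set v := volume (Metric.ball (0 : EuclideanSpace ℝ (Fin n)) 1)
  have hvt : v ≠ ∞ := measure_ball_lt_top.ne
  set G := (1 - ENNReal.ofReal (D / 2 ^ n) ^ (2 / p))⁻¹ ^ (p / 2)
  have hG : G ≠ ∞ := by
    have hq : ENNReal.ofReal (D / 2 ^ n) ^ (2 / p) < 1 :=
      ENNReal.rpow_lt_one (by rwa [ENNReal.ofReal_lt_one, div_lt_one (by positivity)])
        (by positivity)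
    exact ENNReal.rpow_ne_top_of_nonneg (by positivity)
      (ENNReal.inv_ne_top.2 (tsub_pos_of_lt hq).ne')
  have hK : v ^ (p - 1) * ENNReal.ofReal D ^ 2 * G * v ≠ ∞ :=
    ENNReal.mul_ne_top (ENNReal.mul_ne_top (ENNReal.mul_ne_top
      (ENNReal.rpow_ne_top_of_nonneg (sub_nonneg.2 hp) hvt)
      (ENNReal.pow_ne_top ENNReal.ofReal_ne_top)) hG) hvt
  refine ⟨(v ^ (p - 1) * ENNReal.ofReal D ^ 2 * G * v).toNNReal,
    fun Φ hΦ f hf C hC x₀ r hr hf0 => ?_⟩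
  rw [ENNReal.coe_toNNReal hK]
  have hr0 : ENNReal.ofReal r ^ n ≠ 0 := pow_ne_zero n (by simpa using hr)
  have hrt : ENNReal.ofReal r ^ n ≠ ∞ := ENNReal.pow_ne_top ENNReal.ofReal_ne_top
  calc ∫⁻ x in Metric.ball x₀ r, gFun α f x ^ p
      ≤ ∫⁻ _x in Metric.ball x₀ r, v ^ (p - 1) * ENNReal.ofReal D ^ 2 *
          (C ^ p * ENNReal.ofReal (Φ r) / ENNReal.ofReal r ^ n) * G :=
        setLIntegral_mono' measurableSet_ball fun x hx =>
          gFun_rpow_le_of_isMorreyBound hα hp hD hΦ hf hC hr hx hf0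
    _ = v ^ (p - 1) * ENNReal.ofReal D ^ 2 * G * v *
          (C ^ p * ENNReal.ofReal (Φ r) / ENNReal.ofReal r ^ n * ENNReal.ofReal r ^ n) := by
        rw [setLIntegral_const, Measure.addHaar_ball_of_pos _ _ hr, finrank_euclideanSpace_fin,
          ENNReal.ofReal_pow hr.le]
        ring
    _ = _ := by rw [ENNReal.div_mul_cancel hr0 hrt]

lemma lintegral_enorm_indicator_rpow {X : Type*} [MeasurableSpace X] {μ : Measure X} {s : Set X}
    (hs : MeasurableSet s) (hp : 0 < p) (f : X → 𝕜) :
    ∫⁻ x, ‖s.indicator f x‖ₑ ^ p ∂μ = ∫⁻ x in s, ‖f x‖ₑ ^ p ∂μ := by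
  rw [← lintegral_indicator hs]
  refine lintegral_congr fun x => ?_
  by_cases hx : x ∈ s <;> simp [hx, hp]

lemma integrable_indicator_ball {f : EuclideanSpace ℝ (Fin n) → 𝕜} (hf : LocallyIntegrable f)
    (x₀ : EuclideanSpace ℝ (Fin n)) (r : ℝ) : Integrable ((Metric.ball x₀ r).indicator f) :=
  ((hf.integrableOn_isCompact (isCompact_closedBall x₀ r)).mono_set
    Metric.ball_subset_closedBall).integrable_indicator measurableSet_ball

lemma exists_lintegral_gFun_indicator_ball_rpow_le [NeZero n] (hα : 0 < α) (hp : 1 < p)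
    (hD : 0 ≤ D) :
    ∃ K : ℝ≥0, ∀ Φ : ℝ → ℝ, (∀ r, 0 < r → Φ (2 * r) ≤ D * Φ r) →
      ∀ f : EuclideanSpace ℝ (Fin n) → 𝕜, LocallyIntegrable f →
      ∀ C ≠ ∞, IsMorreyBound p Φ f C → ∀ x₀ r, 0 < r →
        ∫⁻ x, gFun α ((Metric.ball x₀ (2 * r)).indicator f) x ^ p ≤
          K * (C ^ p * ENNReal.ofReal (Φ r)) := by
  have hp0 : 0 < p := zero_lt_one.trans hp
  obtain ⟨K, hK⟩ := exists_lintegral_gFun_rpow_le n 𝕜 hα hp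
  refine ⟨K * D.toNNReal, fun Φ hΦ f hf C hCt hC x₀ r hr => ?_⟩
  have hle : ∫⁻ x, ‖(Metric.ball x₀ (2 * r)).indicator f x‖ₑ ^ p ≤
      ENNReal.ofReal D * (C ^ p * ENNReal.ofReal (Φ r)) := by
    rw [lintegral_enorm_indicator_rpow measurableSet_ball hp0]
    simpa only [pow_one] using hC.setLIntegral_ball_pow_le hD hΦ x₀ hr 1
  have hfin : ENNReal.ofReal D * (C ^ p * ENNReal.ofReal (Φ r)) < ∞ :=
    ENNReal.mul_lt_top ENNReal.ofReal_lt_top <|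
      ENNReal.mul_lt_top (ENNReal.rpow_lt_top_of_nonneg hp0.le hCt) ENNReal.ofReal_lt_top
  calc ∫⁻ x, gFun α ((Metric.ball x₀ (2 * r)).indicator f) x ^ p
      ≤ K * ∫⁻ x, ‖(Metric.ball x₀ (2 * r)).indicator f x‖ₑ ^ p :=
        hK _ (integrable_indicator_ball hf x₀ _) (hle.trans_lt hfin)
    _ ≤ K * (ENNReal.ofReal D * (C ^ p * ENNReal.ofReal (Φ r))) := by gcongr
    _ = (K * D.toNNReal : ℝ≥0) * (C ^ p * ENNReal.ofReal (Φ r)) := by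
        rw [ENNReal.coe_mul, mul_assoc, ENNReal.ofReal]

lemma exists_isMorreyBound_gFun [NeZero n] (hα : 0 < α) (hp : 1 < p) (hD : 0 ≤ D)
    (hDn : D < 2 ^ n) :
    ∃ K : ℝ≥0, ∀ Φ : ℝ → ℝ, (∀ r, 0 < r → Φ (2 * r) ≤ D * Φ r) →
      ∀ f : EuclideanSpace ℝ (Fin n) → 𝕜, LocallyIntegrable f →
      ∀ C ≠ ∞, IsMorreyBound p Φ f C → IsMorreyBound p Φ (gFun α f) (K * C) := by
  have hp0 : 0 < p := zero_lt_one.trans hp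
  obtain ⟨K₁, hK₁⟩ := exists_lintegral_gFun_indicator_ball_rpow_le (n := n) (𝕜 := 𝕜) hα hp hD
  obtain ⟨K₂, hK₂⟩ := exists_setLIntegral_gFun_rpow_le_of_eq_zero (n := n) (𝕜 := 𝕜) hα hp.le hD hDn
  refine ⟨(2 ^ (p - 1) * (K₁ + K₂)) ^ p⁻¹, fun Φ hΦ f hf C hCt hC x₀ r hr => ?_⟩
  set B := Metric.ball x₀ (2 * r)
  set M := C ^ p * ENNReal.ofReal (Φ r)
  have hf_near : LocallyIntegrable (B.indicator f) :=
    (integrable_indicator_ball hf x₀ _).locallyIntegrable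
  have hf_far : LocallyIntegrable (Bᶜ.indicator f) := hf.indicator measurableSet_ball.compl
  have hnear : ∫⁻ x in Metric.ball x₀ r, gFun α (B.indicator f) x ^ p ≤ K₁ * M :=
    (setLIntegral_le_lintegral _ _).trans (hK₁ Φ hΦ f hf C hCt hC x₀ r hr)
  have hfar : ∫⁻ x in Metric.ball x₀ r, gFun α (Bᶜ.indicator f) x ^ p ≤ K₂ * M :=
    hK₂ Φ hΦ _ hf_far C (hC.mono hp0.le (enorm_indicator_le_enorm_self f)) x₀ r hr
      fun z hz => indicator_of_notMem (notMem_compl_iff.2 hz) f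
  calc ∫⁻ x in Metric.ball x₀ r, ‖gFun α f x‖ₑ ^ p
      ≤ 2 ^ (p - 1) * ((∫⁻ x in Metric.ball x₀ r, gFun α (B.indicator f) x ^ p) +
          ∫⁻ x in Metric.ball x₀ r, gFun α (Bᶜ.indicator f) x ^ p) := by
        refine lintegral_rpow_le_of_le_add (measurable_gFun hα hf_near).aemeasurable
          (fun x => ?_) hp.le
        simpa [indicator_self_add_compl] using gFun_add_le hα hf_near hf_far x
    _ ≤ 2 ^ (p - 1) * (K₁ * M + K₂ * M) := by gcongr
    _ = (((2 ^ (p - 1) * (K₁ + K₂)) ^ p⁻¹ : ℝ≥0) * C) ^ p * ENNReal.ofReal (Φ r) := by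
        rw [ENNReal.mul_rpow_of_nonneg _ _ hp0.le, ← ENNReal.coe_rpow_of_nonneg _ hp0.le,
          NNReal.rpow_inv_rpow hp0.ne']
        push_cast [ENNReal.coe_rpow_of_nonneg _ (sub_nonneg.2 hp.le)]
        simp only [M]
        ring

end Morrey

end IntrinsicMorrey

open IntrinsicMorrey in
theorem corollary1p7_general {𝕜 : Type*} [RCLike 𝕜] (n : ℕ) [NeZero n] (α p D : ℝ) (Φ : ℝ → ℝ)
    (hα : 0 < α) (hp : 1 < p) (hpos : ∀ r, 0 < r → 0 < Φ r)
    (hΦ : ∀ r, 0 < r → Φ (2 * r) ≤ D * Φ r) (hD : D < 2 ^ n) :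
    ∃ C : ℝ≥0, 0 < C ∧ ∀ f : EuclideanSpace ℝ (Fin n) → 𝕜, MemMorrey p Φ f →
      MemMorrey p Φ (gFun α f) ∧ morreyNorm p Φ (gFun α f) ≤ C * morreyNorm p Φ f := by
  have hD0 : 0 ≤ D :=
    (pos_of_mul_pos_left ((hpos _ (by norm_num)).trans_le (hΦ 1 one_pos)) (hpos 1 one_pos).le).le
  obtain ⟨K, hK⟩ := exists_isMorreyBound_gFun (𝕜 := 𝕜) hα hp hD0 hD
  have hbound : ∀ {f : EuclideanSpace ℝ (Fin n) → 𝕜} {C : ℝ≥0∞}, LocallyIntegrable f → C ≠ ∞ →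
      IsMorreyBound p Φ f C → IsMorreyBound p Φ (gFun α f) ((K + 1 : ℝ≥0) * C) :=
    fun hf hC h x₀ r hr => (hK Φ hΦ _ hf _ hC h x₀ r hr).trans (by gcongr; simp)
  refine ⟨K + 1, by positivity, fun f ⟨hf, hfin⟩ => ?_⟩
  have hnorm : morreyNorm p Φ (gFun α f) ≤ (K + 1 : ℝ≥0) * morreyNorm p Φ f := by
    rw [← ENNReal.div_le_iff' (by simp) (by simp)]
    refine le_sInf fun C h => ?_
    rcases eq_or_ne C ∞ with rfl | hC
    · exact le_top
    · exact ENNReal.div_le_of_le_mul' (sInf_le (hbound hf hC h))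
  obtain ⟨C, h, hC⟩ := sInf_lt_iff.1 hfin
  exact ⟨⟨(hbound hf hC.ne h).locallyIntegrable (by finiteness) hp.le
    (measurable_gFun hα hf).aestronglyMeasurable,
    hnorm.trans_lt (ENNReal.mul_lt_top ENNReal.coe_lt_top hfin)⟩, hnorm⟩

end

theorem corollary1p7 {𝕜 : Type*} [RCLike 𝕜] (n : ℕ) (α p D : ℝ) (Φ : ℝ → ℝ)
    (hα0 : 0 < α) (hα1 : α ≤ 1) (hp : 1 < p)
    (hΦ : IntrinsicMorrey.IsGrowthFunction Φ D) (hD : D < 2 ^ n) :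
    ∃ C : ℝ≥0, 0 < C ∧ ∀ f : EuclideanSpace ℝ (Fin n) → 𝕜,
      IntrinsicMorrey.MemMorrey p Φ f →
        IntrinsicMorrey.MemMorrey p Φ (IntrinsicMorrey.gFun α f) ∧
        IntrinsicMorrey.morreyNorm p Φ (IntrinsicMorrey.gFun α f) ≤
          C * IntrinsicMorrey.morreyNorm p Φ f := by
  have : NeZero n := ⟨by rintro rfl; exact hD.not_ge (by simpa using hΦ.one_le)⟩
  exact corollary1p7_general n α p D Φ hα0 hp hΦ.pos hΦ.doubling hD
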